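/- Let $c>0$, $r>0$, $x_0\in\mathbf R^3$, let $\chi_{B_{x_0,r}}$ be the characteristic function of the closed ball $B_{x_0,r}=\{x\in\mathbf R^3:|x-x_0|\le r\}$, let $\chi_{[a,b]}$ be the characteristic function of the interval $[a,b]$, and put $d=|x-x_0|$. Consider the Cauchy problem $$\partial_t^2u-c^2\Delta u=0\quad (x\in\mathbf R^3,\ t>0),\qquad u(x,0)=f(x),\quad \partial_tu(x,0)=g(x),$$ in the sense of distributions: $u$ is a distribution on $\mathbf R^3\times\mathbf R$ that vanishes for $t<0$ and satisfies $\partial_t^2u-c^2\Delta u=f(x)\,\delta'(t)+g(x)\,\delta(t)$. For each of the two choices of data below there is exactly one such $u$, and it has a well-defined value $u(x,\cdot)$ at every point $x\in\mathbf R^3$, as a distribution in $t$: there is exactly one family $(u(x,\cdot))_{x\in\mathbf R^3}$ of distributions on $\mathbf R$, weakly continuous in $x$, with $\langle u,\Phi\rangle=\int_{\mathbf R^3}\langle u(x,\cdot),\Phi(x,\cdot)\rangle\,\mathrm dx$ for all test functions $\Phi$. These values are zero for $t<0$ and are given by the following formulas, which are identities of distributions in $t$; the terms that are functions of $t$ are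 locally integrable and stand for $\varphi\mapsto\int_0^\infty(\cdot)\,\varphi(t)\,\mathrm dt$. (i) For $(f,g)=(\chi_{B_{x_0,r}},0)$: $$u(x,t)=\begin{cases}\dfrac{d-ct}{2d}\,\chi_{[d-r,d+r]}(ct), & x\in\mathbf R^3\setminus B_{x_0,r},\\[2mm] \chi_{[0,r-d]}(ct)+\dfrac{d-ct}{2d}\,\chi_{[r-d,r+d]}(ct), & x\in B_{x_0,r}\setminus\{x_0\},\\[2mm] \chi_{[0,r]}(ct)-c\,t\,\delta(r-ct), & x=x_0,\end{cases}$$ where $\delta(r-ct)$ is the distribution $\varphi\mapsto\frac1c\varphi(r/c)$ in $t$. (ii) For $(f,g)=(0,\chi_{B_{x_0,r}})$: $$u(x,t)=\begin{cases}\dfrac t2\Bigl(1-\dfrac{(ct)^2+d^2-r^2}{2dct}\Bigr)\chi_{[d-r,d+r]}(ct), & x\in\mathbf R^3\setminus B_{x_0,r},\\[2mm] t\,\chi_{[0,r-d]}(ct)+\dfrac t2\Bigl(1-\dfrac{(ct)^2+d^2-r^2}{2dct}\Bigr)\chi_{[r-d,r+d]}(ct), & x\in B_{x_0,r}\setminus\{x_0\},\\[2mm]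 t\,\chi_{[0,r]}(ct), & x=x_0.\end{cases}$$ -/

import Mathlib

open Set MeasureTheory TopologicalSpace
open scoped Distributions LineDeriv

noncomputable section

namespace WaveCauchy

/-- The physical space `ℝ³` with its Euclidean norm. -/
abbrev Space : Type := EuclideanSpace ℝ (Fin 3)

/-- Space-time `ℝ³ × ℝ`, with points `(x, t)`. -/
abbrev SpaceTime : Type := Space × ℝ

/-- The characteristic function of the closed ball with centre `x₀` and radius `r`. -/
def ballChar (x₀ : Space) (r : ℝ) : Space → ℝ :=
  (Metric.closedBall x₀ r).indicator (fun _ => 1)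

/-- The characteristic function of the closed interval `[a, b]`. -/
def chi (a b : ℝ) : ℝ → ℝ := (Icc a b).indicator (fun _ => 1)

/-- The unit vector of space-time in the time direction. -/
def eTime : SpaceTime := (0, 1)

/-- The unit vector of space-time in the `i`-th space direction. -/
def eSpace (i : Fin 3) : SpaceTime := (EuclideanSpace.single i 1, 0)

/-- The wave operator `∂ₜ² - c² Δ` (with `Δ` the Laplacian in the space variables), acting on
distributions on space-time. -/
def waveOp (c : ℝ) (U : 𝓓'((⊤ : Opens SpaceTime), ℝ)) : 𝓓'((⊤ : Opens SpaceTime), ℝ) :=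
  ∂_{eTime} (∂_{eTime} U) - c ^ 2 • ∑ i : Fin 3, ∂_{eSpace i} (∂_{eSpace i} U)

/-- `U` is a distributional solution of the Cauchy problem
`∂ₜ² u - c² Δ u = 0` for `t > 0`, `u(x, 0) = f(x)`, `∂ₜ u(x, 0) = g(x)`.
As usual, the solution is continued by zero to `t < 0`, and the initial values are imposed weakly:
`∂ₜ² U - c² Δ U = f(x) δ'(t) + g(x) δ(t)`. For a function `u` this is the identity
`∫_{t>0} ∫ u (∂ₜ² Φ - c² Δ Φ) dx dt = ∫ g(x) Φ(x, 0) dx - ∫ f(x) ∂ₜ Φ(x, 0) dx`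
for all test functions `Φ` on `ℝ³ × ℝ`. -/
structure IsSolution (c : ℝ) (f g : Space → ℝ) (U : 𝓓'((⊤ : Opens SpaceTime), ℝ)) : Prop where
  vanishes_past : ∀ Φ : 𝓓((⊤ : Opens SpaceTime), ℝ), tsupport Φ ⊆ {p | p.2 < 0} → U Φ = 0
  weak_eq : ∀ Φ : 𝓓((⊤ : Opens SpaceTime), ℝ),
    waveOp c U Φ = (∫ x : Space, g x * Φ (x, 0)) - ∫ x : Space, f x * (∂_{eTime} Φ) (x, 0)

/-- The restriction `t ↦ Φ(x, t)` of a test function on space-time to the line `{x} × ℝ`. -/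
def slice (Φ : 𝓓((⊤ : Opens SpaceTime), ℝ)) (x : Space) : 𝓓((⊤ : Opens ℝ), ℝ) where
  toFun t := Φ (x, t)
  contDiff' := Φ.contDiff.comp (contDiff_const.prodMk contDiff_id)
  hasCompactSupport' :=
    Φ.hasCompactSupport.comp_isClosedEmbedding (g := fun t : ℝ => ((x, t) : SpaceTime))
      (Function.LeftInverse.isClosedEmbedding (f := Prod.snd) (fun _ => rfl) continuous_snd
        (by fun_prop))
  tsupport_subset' := by simp

/-- `u x` is the value `u(x, ·)` of the space-time distribution `U` at the point `x`, a
distribution in the time variable: the distributions `u x` depend (weakly) continuously on `x`,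
and `U` is obtained from them by integration over `x`. -/
structure IsValueAtPoints (U : 𝓓'((⊤ : Opens SpaceTime), ℝ))
    (u : Space → 𝓓'((⊤ : Opens ℝ), ℝ)) : Prop where
  continuous : ∀ φ : 𝓓((⊤ : Opens ℝ), ℝ), Continuous fun x => u x φ
  disintegration : ∀ Φ : 𝓓((⊤ : Opens SpaceTime), ℝ), U Φ = ∫ x : Space, u x (slice Φ x)

/-- The distribution `T` in the time variable is given by the function `h` for `t > 0` (and is
zero for `t < 0`): it is `φ ↦ ∫_{t>0} h(t) φ(t) dt`. -/
def IsGivenBy (T : 𝓓'((⊤ : Opens ℝ), ℝ)) (h : ℝ → ℝ) : Prop :=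
  ∀ φ : 𝓓((⊤ : Opens ℝ), ℝ), IntegrableOn (fun t => h t * φ t) (Ioi 0) ∧
    T φ = ∫ t in Ioi (0 : ℝ), h t * φ t

/-- The pairing `∫ δ(a - b t) ψ(t) dt = ψ(a / b) / |b|` of the distribution `δ(a - b t)`, `b ≠ 0`,
in the variable `t`, with a function `ψ`. -/
def deltaPairing (a b : ℝ) (ψ : ℝ → ℝ) : ℝ := |b|⁻¹ * ψ (a / b)

end WaveCauchy

end

noncomputable section

namespace WaveCauchy

open scoped ContDiff Topology Convolution
open Filter

/-! ### Directional derivatives and the classical wave operator -/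

/-! Everything rests on the retarded potential E = δ(t − |y|/c) / (4πc²|y|), a positive measure on
the forward light cone with (∂ₜ² − c²Δ)E = δ (`integral_waveFun_cone`). Convolving E with χ(x)δ(t)
solves the problem with data (0, χ); the time derivative of that solution solves the problem with
data (χ, 0) (`IsSolution.timeDeriv`).

The cone is singular at its tip, so it is approximated by the hyperboloids (ct)² = |y|² + ε². With ρ
= √(|y|² + ε²), an explicit vector field has divergence (∂ₜ²f − c²Δf)/ρ up to terms carrying a
factor ε² (`sum_dirDeriv_waveField`), and the divergence integrates to zero. As ε → 0 a single error
term survives; it concentrates at the origin and yields 4πc² f(0).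

Uniqueness is by duality: up to a function supported in t ≤ −1, each test function is the wave
operator applied to its advanced potential, cut off in the past (`eq_zero_of_waveOp_eq_zero`).

By Fubini, the value of the solution at x is the image of dy/(4πc²|y|), restricted to the ball of
radius r about x − x₀, under y ↦ |y|/c. By Archimedes, that ball cuts from the sphere of radius R
about 0 a cap of area 2πR·h(R), so the value has density h(ct)/(2c) in t. The height h is 0, the
full 2R, or (r² − (R − d)²)/(2d), whence the cases in (ii). The formulas in (i) follow by
differentiation: for x ≠ x₀ the density is continuous and no delta appears, whereas at x₀ it drops
from r/c to 0. -/

/-- The directional derivative of a function along `v`. -/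
def dirDeriv {E : Type*} [NormedAddCommGroup E] [NormedSpace ℝ E] (v : E) (f : E → ℝ) : E → ℝ :=
  fun p => fderiv ℝ f p v

/-- The wave operator acting on functions. -/
def waveFun (c : ℝ) (f : SpaceTime → ℝ) : SpaceTime → ℝ := fun p =>
  dirDeriv eTime (dirDeriv eTime f) p
    - c ^ 2 * ∑ i : Fin 3, dirDeriv (eSpace i) (dirDeriv (eSpace i) f) p

/-- The wave operator acting on test functions. -/
def waveTest (c : ℝ) (Φ : 𝓓((⊤ : Opens SpaceTime), ℝ)) : 𝓓((⊤ : Opens SpaceTime), ℝ) :=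
  ∂_{eTime} (∂_{eTime} Φ) - c ^ 2 • ∑ i : Fin 3, ∂_{eSpace i} (∂_{eSpace i} Φ)

section dirDeriv

variable {E : Type*} [NormedAddCommGroup E] [NormedSpace ℝ E] {f : E → ℝ}

lemma contDiff_dirDeriv (hf : ContDiff ℝ ∞ f) (v : E) : ContDiff ℝ ∞ (dirDeriv v f) :=
  (hf.fderiv_right (m := ∞) (by simp)).clm_apply contDiff_const

lemma hasCompactSupport_dirDeriv (hf : HasCompactSupport f) (v : E) :
    HasCompactSupport (dirDeriv v f) :=
  hf.fderiv_apply ℝ v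

lemma dirDeriv_comm (hf : ContDiff ℝ ∞ f) (v w : E) (p : E) :
    dirDeriv v (dirDeriv w f) p = dirDeriv w (dirDeriv v f) p := by
  have hd : DifferentiableAt ℝ (fderiv ℝ f) p :=
    ((hf.fderiv_right (m := ∞) (by simp)).differentiable (by simp)) p
  have key : ∀ a b : E, dirDeriv a (dirDeriv b f) p = fderiv ℝ (fderiv ℝ f) p a b := by
    intro a b
    change fderiv ℝ (fun q => fderiv ℝ f q b) p a = _
    rw [fderiv_clm_apply hd (differentiableAt_const b)]
    simp
  rw [key, key]
  exact (hf.contDiffAt.isSymmSndFDerivAt (by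
    simpa using (WithTop.coe_le_coe.2 le_top : ((2 : ℕ∞) : WithTop ℕ∞) ≤ ∞))) v w

end dirDeriv

lemma lineDerivOp_testFunction_apply {E : Type*} [NormedAddCommGroup E] [NormedSpace ℝ E]
    (Φ : 𝓓((⊤ : Opens E), ℝ)) (v : E) : ⇑(∂_{v} Φ : 𝓓((⊤ : Opens E), ℝ)) = dirDeriv v Φ := by
  ext p
  rw [TestFunction.lineDerivOp_eq_lineDerivCLM ℝ, TestFunction.lineDerivCLM_eq_fderivCLM]
  simp [dirDeriv]

lemma coe_waveTest (c : ℝ) (Φ : 𝓓((⊤ : Opens SpaceTime), ℝ)) :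
    ⇑(waveTest c Φ) = waveFun c Φ := by
  ext p
  simp only [waveTest, waveFun, ← lineDerivOp_testFunction_apply]
  simp [Fin.sum_univ_three, mul_add]

/-- Only second derivatives occur, so the two signs from the transpositions cancel: the wave
operator is its own transpose. -/
lemma waveOp_apply (c : ℝ) (U : 𝓓'((⊤ : Opens SpaceTime), ℝ)) (Φ : 𝓓((⊤ : Opens SpaceTime), ℝ)) :
    waveOp c U Φ = U (waveTest c Φ) := by
  have h : ∀ v : SpaceTime, (∂_{v} (∂_{v} U)) Φ = U (∂_{v} (∂_{v} Φ)) := by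
    intro v
    simp
  simp only [waveOp, waveTest, Fin.sum_univ_three, map_sub, map_add, map_smul, ← h]
  rfl

lemma contDiff_waveFun {c : ℝ} {f : SpaceTime → ℝ} (hf : ContDiff ℝ ∞ f) :
    ContDiff ℝ ∞ (waveFun c f) := by
  unfold waveFun
  have := fun v w => contDiff_dirDeriv (contDiff_dirDeriv hf v) w
  fun_prop

/-! ### Distributions given by measures -/

section Measure

variable {E : Type*} [NormedAddCommGroup E] [NormedSpace ℝ E] [MeasurableSpace E] [BorelSpace E]

/-- The distribution `φ ↦ ∫ φ dμ`. -/
def ofMeasure (μ : Measure E) : 𝓓'((⊤ : Opens E), ℝ) :=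
  TestFunction.integralAgainstBilinCLM (ContinuousLinearMap.mul ℝ ℝ) μ (fun _ => (1 : ℝ))

lemma ofMeasure_apply (μ : Measure E) [IsLocallyFiniteMeasure μ] (φ : 𝓓((⊤ : Opens E), ℝ)) :
    ofMeasure μ φ = ∫ x, φ x ∂μ := by
  have h : LocallyIntegrableOn (fun _ : E => (1 : ℝ)) ((⊤ : Opens E) : Set E) μ :=
    (locallyIntegrable_const 1).locallyIntegrableOn _
  refine (TestFunction.integralAgainstBilinCLM_eq_integral h).trans ?_
  simp

end Measure

/-- Preimages of bounded sets are bounded, hence of finite measure since the source is a proper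
space. -/
lemma isLocallyFiniteMeasure_map {X Y : Type*} [NormedAddCommGroup X] [NormedAddCommGroup Y]
    [ProperSpace X] [MeasurableSpace X] [BorelSpace X] [MeasurableSpace Y] [BorelSpace Y]
    {μ : Measure X} [IsLocallyFiniteMeasure μ] {g : X → Y} (hg : Measurable g)
    (h : ∀ R, ∃ R', ∀ x, ‖g x‖ ≤ R → ‖x‖ ≤ R') : IsLocallyFiniteMeasure (μ.map g) := by
  refine ⟨fun y => ⟨Metric.closedBall y 1, Metric.closedBall_mem_nhds y one_pos, ?_⟩⟩
  rw [Measure.map_apply hg Metric.isClosed_closedBall.measurableSet]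
  obtain ⟨R', hR'⟩ := h (‖y‖ + 1)
  refine lt_of_le_of_lt (measure_mono (t := Metric.closedBall 0 R') ?_)
    (isCompact_closedBall 0 R').measure_lt_top
  intro x hx
  have : ‖g x - y‖ ≤ 1 := by simpa [dist_eq_norm] using hx
  have h2 : ‖g x‖ ≤ ‖g x - y‖ + ‖y‖ := by simpa using norm_add_le (g x - y) y
  simpa using hR' x (by linarith)

/-! ### The measure with the retarded potential as density -/

/-- The density `1 / (4 π c² |y|)`. -/
def newton (c : ℝ) (y : Space) : ℝ := (4 * Real.pi * c ^ 2 * ‖y‖)⁻¹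

lemma newton_nonneg (c : ℝ) (y : Space) : 0 ≤ newton c y := by
  unfold newton; positivity

lemma measurable_newton (c : ℝ) : Measurable (newton c) := by
  unfold newton; fun_prop

lemma locallyIntegrable_inv_norm : LocallyIntegrable (fun y : Space => ‖y‖⁻¹) := by
  refine locallyIntegrable_of_norm_le_rpow (C := 1) (α := 1) (by simp) (by simp) ?_ ?_
  · refine Filter.Eventually.of_forall fun y => ?_
    simp [Real.rpow_neg_one]
  · exact (by fun_prop : Measurable fun y : Space => ‖y‖⁻¹).aestronglyMeasurable

lemma locallyIntegrable_newton (c : ℝ) : LocallyIntegrable (newton c) := by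
  have : newton c = fun y => (4 * Real.pi * c ^ 2)⁻¹ • ‖y‖⁻¹ := by
    ext y; simp [newton]; ring
  rw [this]
  exact locallyIntegrable_inv_norm.smul (4 * Real.pi * c ^ 2)⁻¹

/-- The measure `dy / (4 π c² |y|)` on `ℝ³`. -/
def newtonMeasure (c : ℝ) : Measure Space :=
  volume.withDensity fun y => ENNReal.ofReal (newton c y)

instance (c : ℝ) : IsLocallyFiniteMeasure (newtonMeasure c) := by
  refine ⟨fun y => ⟨Metric.closedBall y 1, Metric.closedBall_mem_nhds y one_pos, ?_⟩⟩
  rw [newtonMeasure, withDensity_apply _ Metric.isClosed_closedBall.measurableSet]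
  have h := (locallyIntegrable_newton c).integrableOn_isCompact (isCompact_closedBall y 1)
  exact h.lintegral_lt_top

instance (c : ℝ) : SFinite (newtonMeasure c) := by unfold newtonMeasure; infer_instance

lemma newtonMeasure_absolutelyContinuous (c : ℝ) : newtonMeasure c ≪ volume :=
  withDensity_absolutelyContinuous _ _

lemma integral_newtonMeasure (c : ℝ) (f : Space → ℝ) :
    ∫ y, f y ∂(newtonMeasure c) = ∫ y, newton c y * f y := by
  rw [newtonMeasure, integral_withDensity_eq_integral_toReal_smul
    (measurable_newton c).ennreal_ofReal (by simp)]
  simp [ENNReal.toReal_ofReal (newton_nonneg c _)]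

/-- The point of the forward light cone over `y`. -/
def cone (c : ℝ) (y : Space) : SpaceTime := (y, ‖y‖ / c)

@[fun_prop]
lemma continuous_cone (c : ℝ) : Continuous (cone c) := by
  unfold cone; fun_prop

/-! ### The retarded potential is a fundamental solution of the wave equation -/

/-- The regularization `√(|y|² + ε²)` of the norm. -/
def regNorm (ε : ℝ) (y : Space) : ℝ := √(‖y‖ ^ 2 + ε ^ 2)

/-- The point over `y` on the upper sheet of the hyperboloid `(c t)² = |y|² + ε²`. -/
def hyperboloid (c ε : ℝ) (y : Space) : SpaceTime := (y, regNorm ε y / c)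

lemma regNorm_sq (ε : ℝ) (y : Space) : regNorm ε y ^ 2 = ‖y‖ ^ 2 + ε ^ 2 :=
  Real.sq_sqrt (by positivity)

lemma regNorm_pos {ε : ℝ} (hε : 0 < ε) (y : Space) : 0 < regNorm ε y :=
  Real.sqrt_pos.2 (by positivity)

lemma norm_le_regNorm (ε : ℝ) (y : Space) : ‖y‖ ≤ regNorm ε y :=
  Real.le_sqrt_of_sq_le (by nlinarith [sq_nonneg ε])

lemma regNorm_zero (y : Space) : regNorm 0 y = ‖y‖ := by simp [regNorm]

lemma hyperboloid_zero (c : ℝ) (y : Space) : hyperboloid c 0 y = cone c y := by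
  simp [hyperboloid, cone, regNorm_zero]

lemma regNorm_smul {ε : ℝ} (hε : 0 < ε) (z : Space) : regNorm ε (ε • z) = ε * regNorm 1 z := by
  rw [regNorm, regNorm, norm_smul, Real.norm_of_nonneg hε.le]
  rw [show (ε * ‖z‖) ^ 2 + ε ^ 2 = ε ^ 2 * (‖z‖ ^ 2 + 1 ^ 2) by ring,
    Real.sqrt_mul (by positivity), Real.sqrt_sq hε.le]

/-- The hyperboloids are dilates of one another; this is how error terms of the regularization are
rescaled to ε = 1. -/
lemma hyperboloid_smul {c ε : ℝ} (hε : 0 < ε) (z : Space) :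
    hyperboloid c ε (ε • z) = ε • hyperboloid c 1 z := by
  simp [hyperboloid, regNorm_smul hε, mul_div_assoc]

lemma contDiff_regNorm {ε : ℝ} (hε : 0 < ε) : ContDiff ℝ ∞ (regNorm ε) := by
  unfold regNorm
  exact ((contDiff_norm_sq ℝ).add contDiff_const).sqrt fun y => by positivity

@[fun_prop]
lemma continuous_regNorm (ε : ℝ) : Continuous (regNorm ε) := by
  unfold regNorm; fun_prop

@[fun_prop]
lemma continuous_hyperboloid (c ε : ℝ) : Continuous (hyperboloid c ε) := by
  unfold hyperboloid; fun_prop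

lemma contDiff_hyperboloid {c ε : ℝ} (hε : 0 < ε) : ContDiff ℝ ∞ (hyperboloid c ε) :=
  contDiff_id.prodMk ((contDiff_regNorm hε).div_const c)

lemma hasCompactSupport_comp_hyperboloid {w : SpaceTime → ℝ} (hw : HasCompactSupport w) (c ε : ℝ) :
    HasCompactSupport fun y => w (hyperboloid c ε y) :=
  hw.comp_isClosedEmbedding
    (Function.LeftInverse.isClosedEmbedding (f := Prod.fst) (fun _ => rfl) continuous_fst
      (continuous_hyperboloid c ε))

lemma hasDerivAt_regNorm_line {ε : ℝ} (hε : 0 < ε) (y : Space) (i : Fin 3) :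
    HasDerivAt (fun s : ℝ => regNorm ε (y + s • EuclideanSpace.single i 1))
      (y i / regNorm ε y) 0 := by
  have h1 : HasDerivAt (fun s : ℝ => y + s • (EuclideanSpace.single i 1 : Space))
      (EuclideanSpace.single i 1) 0 := by
    simpa using ((hasDerivAt_id (0 : ℝ)).smul_const (EuclideanSpace.single i 1 : Space)).const_add y
  have h2 := (h1.norm_sq.add_const (ε ^ 2)).sqrt (by positivity)
  have h3 := regNorm_pos hε y
  refine HasDerivAt.congr_deriv h2 ?_
  simp only [zero_smul, add_zero]
  rw [EuclideanSpace.inner_single_right]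
  change 2 * _ / (2 * regNorm ε y) = _
  simp only [RCLike.conj_to_real, one_mul]
  field_simp

lemma hasDerivAt_comp_hyperboloid_line {c ε : ℝ} (hε : 0 < ε) {f : SpaceTime → ℝ}
    (hf : ContDiff ℝ ∞ f) (y : Space) (i : Fin 3) :
    HasDerivAt (fun s : ℝ => f (hyperboloid c ε (y + s • EuclideanSpace.single i 1)))
      (dirDeriv (eSpace i) f (hyperboloid c ε y)
        + dirDeriv eTime f (hyperboloid c ε y) * (y i / regNorm ε y / c)) 0 := by
  have h1 : HasDerivAt (fun s : ℝ => y + s • (EuclideanSpace.single i 1 : Space))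
      (EuclideanSpace.single i 1) 0 := by
    simpa using ((hasDerivAt_id (0 : ℝ)).smul_const (EuclideanSpace.single i 1 : Space)).const_add y
  have h2 : HasDerivAt
      (fun s : ℝ => hyperboloid c ε (y + s • EuclideanSpace.single i 1))
      (eSpace i + (y i / regNorm ε y / c) • eTime) 0 := by
    refine (h1.prodMk ((hasDerivAt_regNorm_line hε y i).div_const c)).congr_deriv ?_
    simp [eSpace, eTime]
  have h3 : HasFDerivAt f (fderiv ℝ f (hyperboloid c ε y))
      (hyperboloid c ε (y + (0 : ℝ) • EuclideanSpace.single i 1)) := by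
    simpa using ((hf.differentiable (by simp)) (hyperboloid c ε y)).hasFDerivAt
  refine (h3.comp_hasDerivAt 0 h2).congr_deriv ?_
  simp [dirDeriv]; ring

/-- The components of a vector field on `ℝ³` with divergence close to `□f / ρ`. -/
def waveField (c ε : ℝ) (f : SpaceTime → ℝ) (i : Fin 3) (y : Space) : ℝ :=
  -c ^ 2 * (dirDeriv (eSpace i) f (hyperboloid c ε y) / regNorm ε y)
    + c * (dirDeriv eTime f (hyperboloid c ε y) * y i / regNorm ε y ^ 2)
    - c ^ 2 * (f (hyperboloid c ε y) * y i / regNorm ε y ^ 3)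

lemma contDiff_waveField {c ε : ℝ} (hε : 0 < ε) {f : SpaceTime → ℝ} (hf : ContDiff ℝ ∞ f)
    (i : Fin 3) : ContDiff ℝ ∞ (waveField c ε f i) := by
  have hr := contDiff_regNorm hε
  have hp := contDiff_hyperboloid (c := c) hε
  have hne : ∀ (k : ℕ) y, regNorm ε y ^ k ≠ 0 := fun k y => (pow_pos (regNorm_pos hε y) k).ne'
  have h0 := hf.comp hp
  have h1 := (contDiff_dirDeriv hf (eSpace i)).comp hp
  have h2 := (contDiff_dirDeriv hf eTime).comp hp
  have hy : ContDiff ℝ ∞ fun y : Space => y i := by fun_prop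
  have a1 := h1.div hr fun y => (regNorm_pos hε y).ne'
  have a2 := (h2.mul hy).div (hr.pow 2) (hne 2)
  have a3 := (h0.mul hy).div (hr.pow 3) (hne 3)
  exact ((contDiff_const.mul a1).add (contDiff_const.mul a2)).sub (contDiff_const.mul a3)

lemma hasCompactSupport_waveField {c ε : ℝ} {f : SpaceTime → ℝ}
    (hs : HasCompactSupport f) (i : Fin 3) : HasCompactSupport (waveField c ε f i) := by
  have h0 := hasCompactSupport_comp_hyperboloid hs c ε
  have h1 := hasCompactSupport_comp_hyperboloid (hasCompactSupport_dirDeriv hs (eSpace i)) c ε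
  have h2 := hasCompactSupport_comp_hyperboloid (hasCompactSupport_dirDeriv hs eTime) c ε
  have a1 : HasCompactSupport fun y =>
      -c ^ 2 * (dirDeriv (eSpace i) f (hyperboloid c ε y) / regNorm ε y) := by
    simp only [div_eq_mul_inv]; exact h1.mul_right.mul_left
  have a2 : HasCompactSupport fun y =>
      c * (dirDeriv eTime f (hyperboloid c ε y) * y i / regNorm ε y ^ 2) := by
    simp only [div_eq_mul_inv]; exact h2.mul_right.mul_right.mul_left
  have a3 : HasCompactSupport fun y =>
      c ^ 2 * (f (hyperboloid c ε y) * y i / regNorm ε y ^ 3) := by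
    simp only [div_eq_mul_inv]; exact h0.mul_right.mul_right.mul_left
  exact (a1.add a2).sub a3

/-- The second term of the field cancels the mixed derivatives ∂ₜ∂ᵢf produced by the first, and the
third cancels the first-order derivatives ∂ᵢf. -/
lemma dirDeriv_waveField {c ε : ℝ} (hc : 0 < c) (hε : 0 < ε) {f : SpaceTime → ℝ}
    (hf : ContDiff ℝ ∞ f) (i : Fin 3) (y : Space) :
    dirDeriv (EuclideanSpace.single i 1) (waveField c ε f i) y =
      -c ^ 2 * dirDeriv (eSpace i) (dirDeriv (eSpace i) f) (hyperboloid c ε y) / regNorm ε y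
      + dirDeriv eTime (dirDeriv eTime f) (hyperboloid c ε y) * y i ^ 2 / regNorm ε y ^ 3
      + c * dirDeriv eTime f (hyperboloid c ε y) *
        (1 / regNorm ε y ^ 2 - 3 * y i ^ 2 / regNorm ε y ^ 4)
      - c ^ 2 * f (hyperboloid c ε y) *
        (1 / regNorm ε y ^ 3 - 3 * y i ^ 2 / regNorm ε y ^ 5) := by
  have hA : HasLineDerivAt ℝ (waveField c ε f i)
      (dirDeriv (EuclideanSpace.single i 1) (waveField c ε f i) y) y
      (EuclideanSpace.single i 1) :=
    (((contDiff_waveField hε hf i).differentiable (by simp)) y).hasFDerivAt.hasLineDerivAt _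
  have hρ := regNorm_pos hε y
  have hr := hasDerivAt_regNorm_line hε y i
  have hi : HasDerivAt (fun s : ℝ => (y + s • (EuclideanSpace.single i 1 : Space)) i) 1 0 := by
    simpa using (hasDerivAt_id (0 : ℝ)).const_add (y i)
  have d0 := hasDerivAt_comp_hyperboloid_line (c := c) hε hf y i
  have d1 := hasDerivAt_comp_hyperboloid_line (c := c) hε (contDiff_dirDeriv hf (eSpace i)) y i
  have d2 := hasDerivAt_comp_hyperboloid_line (c := c) hε (contDiff_dirDeriv hf eTime) y i
  have hne : ∀ k : ℕ, regNorm ε (y + (0 : ℝ) • EuclideanSpace.single i 1) ^ k ≠ 0 :=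
    fun k => (pow_pos (regNorm_pos hε _) k).ne'
  have hB := (((d1.div hr (by simpa using hne 1)).const_mul (-c ^ 2)).add
    (((d2.mul hi).div (hr.pow 2) (hne 2)).const_mul c)).sub
    (((d0.mul hi).div (hr.pow 3) (hne 3)).const_mul (c ^ 2))
  refine (HasDerivAt.unique hA hB).trans ?_
  simp only [Pi.mul_apply, Pi.pow_apply, zero_smul, add_zero, Nat.cast_ofNat, Nat.add_one_sub_one,
    pow_one]
  -- The mixed derivatives arise in both orders and cancel only by symmetry.
  rw [dirDeriv_comm hf eTime (eSpace i)]
  field_simp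
  ring

lemma integral_dirDeriv_eq_zero {E : Type*} [NormedAddCommGroup E] [NormedSpace ℝ E]
    [FiniteDimensional ℝ E] [MeasurableSpace E] [BorelSpace E] (μ : Measure E) [μ.IsAddHaarMeasure]
    {f : E → ℝ} (hf : ContDiff ℝ ∞ f) (hs : HasCompactSupport f) (v : E) :
    ∫ x, dirDeriv v f x ∂μ = 0 := by
  have h := integral_mul_fderiv_eq_neg_fderiv_mul_of_integrable (μ := μ) (f := fun _ : E => (1 : ℝ))
    (g := f) (v := v) (by simp)
    (by
      simp only [one_mul]
      exact (contDiff_dirDeriv hf v).continuous.integrable_of_hasCompactSupport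
          (hasCompactSupport_dirDeriv hs v))
    (by simpa using hf.continuous.integrable_of_hasCompactSupport hs)
    (by fun_prop) (fun x _ => hf.differentiable (by simp) x)
  simpa [dirDeriv] using h

/-- Summing over the coordinates turns yᵢ² into |y|² = ρ² − ε². The parts free of ε form the wave
operator or cancel, since the dimension is 3. -/
lemma sum_dirDeriv_waveField {c ε : ℝ} (hc : 0 < c) (hε : 0 < ε) {f : SpaceTime → ℝ}
    (hf : ContDiff ℝ ∞ f) (y : Space) :
    ∑ i : Fin 3, dirDeriv (EuclideanSpace.single i 1) (waveField c ε f i) y =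
      waveFun c f (hyperboloid c ε y) * (regNorm ε y)⁻¹
      - dirDeriv eTime (dirDeriv eTime f) (hyperboloid c ε y) * (ε ^ 2 * (regNorm ε y ^ 3)⁻¹)
      + 3 * c * (ε ^ 2 * dirDeriv eTime f (hyperboloid c ε y) * (regNorm ε y ^ 4)⁻¹)
      - 3 * c ^ 2 * (ε ^ 2 * f (hyperboloid c ε y) * (regNorm ε y ^ 5)⁻¹) := by
  have hρ := regNorm_pos hε y
  have h1 := regNorm_sq ε y
  have h2 : ‖y‖ ^ 2 = y 0 ^ 2 + y 1 ^ 2 + y 2 ^ 2 := by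
    rw [EuclideanSpace.norm_sq_eq]; simp [Fin.sum_univ_three]
  have h3 : ε ^ 2 = regNorm ε y ^ 2 - (y 0 ^ 2 + y 1 ^ 2 + y 2 ^ 2) := by linarith
  simp only [Fin.sum_univ_three, dirDeriv_waveField hc hε hf, waveFun]
  rw [h3]
  field_simp
  ring

/-- In polar coordinates the radial integrand y²(y² + 1)^(−5/2) has primitive y³ / (3(y² +
1)^(3/2)), which tends to 1/3. This integral fixes the normalization 4πc² of the potential. -/
lemma integral_inv_regNorm_pow_five :
    ∫ z : Space, (regNorm 1 z ^ 5)⁻¹ = 4 * Real.pi / 3 := by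
  have hσ : ∀ y : ℝ, 0 < √(y ^ 2 + 1 ^ 2) := fun y => Real.sqrt_pos.2 (by positivity)
  have hsq : ∀ y : ℝ, √(y ^ 2 + 1 ^ 2) ^ 2 = y ^ 2 + 1 := fun y => by
    rw [Real.sq_sqrt (by positivity)]; ring
  have hd : ∀ y : ℝ, HasDerivAt (fun y : ℝ => y ^ 3 / (3 * √(y ^ 2 + 1 ^ 2) ^ 3))
      (y ^ 2 • (√(y ^ 2 + 1 ^ 2) ^ 5)⁻¹) y := by
    intro y
    have h1 : HasDerivAt (fun y : ℝ => √(y ^ 2 + 1 ^ 2)) (y / √(y ^ 2 + 1 ^ 2)) y := by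
      refine (((hasDerivAt_pow 2 y).add_const (1 ^ 2)).sqrt (by positivity)).congr_deriv ?_
      have := hσ y
      field_simp
      simp
    refine ((hasDerivAt_pow 3 y).fun_div ((h1.fun_pow 3).const_mul 3) ?_).congr_deriv ?_
    · exact (by have := hσ y; positivity)
    · have h2 := hsq y
      have h3 := hσ y
      generalize √(y ^ 2 + 1 ^ 2) = σ at h2 h3
      simp only [Nat.cast_ofNat, Nat.add_one_sub_one, smul_eq_mul]
      field_simp
      linear_combination y ^ 2 * h2
  have hlim : Tendsto (fun y : ℝ => y ^ 3 / (3 * √(y ^ 2 + 1 ^ 2) ^ 3)) atTop (𝓝 (1 / 3)) := by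
    have h1 : Tendsto (fun y : ℝ => (√(1 + (y⁻¹) ^ 2) ^ 3)⁻¹ / 3) atTop
        (𝓝 ((√(1 + 0 ^ 2) ^ 3)⁻¹ / 3)) := by
      refine Tendsto.div_const (Tendsto.inv₀ (Tendsto.pow (Tendsto.sqrt
        ((tendsto_inv_atTop_zero.pow 2).const_add 1)) 3) (by simp)) 3
    refine Tendsto.congr' ?_ (by simpa using h1)
    filter_upwards [eventually_gt_atTop 0] with y hy
    have : √(y ^ 2 + 1 ^ 2) = y * √(1 + (y⁻¹) ^ 2) := by
      rw [show y ^ 2 + 1 ^ 2 = y ^ 2 * (1 + (y⁻¹) ^ 2) by field_simp,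
        Real.sqrt_mul (by positivity), Real.sqrt_sq hy.le]
    rw [this]
    have : 0 < √(1 + (y⁻¹) ^ 2) := Real.sqrt_pos.2 (by positivity)
    field_simp
  have hI := integral_Ioi_of_hasDerivAt_of_nonneg' (a := 0) (fun y _ => hd y)
    (fun y _ => by positivity) hlim
  have key := integral_fun_norm_addHaar (volume : Measure Space)
    (fun y : ℝ => (√(y ^ 2 + 1 ^ 2) ^ 5)⁻¹)
  change ∫ z : Space, (√(‖z‖ ^ 2 + 1 ^ 2) ^ 5)⁻¹ = _
  rw [key]
  simp only [finrank_euclideanSpace, Fintype.card_fin, Nat.add_one_sub_one]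
  rw [hI, measureReal_def, EuclideanSpace.volume_ball_fin_three]
  simp [ENNReal.toReal_ofReal (by positivity : 0 ≤ Real.pi * 4 / 3)]
  ring

lemma integrable_inv_regNorm_pow {k : ℕ} (hk : 3 < k) :
    Integrable fun z : Space => (regNorm 1 z ^ k)⁻¹ := by
  have h := integrable_rpow_neg_one_add_norm_sq (μ := (volume : Measure Space)) (r := (k : ℝ))
    (by simpa using (by exact_mod_cast hk : (3 : ℝ) < k))
  refine h.congr (Eventually.of_forall fun z => ?_)
  have h0 : (0 : ℝ) ≤ 1 + ‖z‖ ^ 2 := by positivity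
  change (1 + ‖z‖ ^ 2) ^ (-(k : ℝ) / 2) = (√(‖z‖ ^ 2 + 1 ^ 2) ^ k)⁻¹
  rw [neg_div, Real.rpow_neg h0, Real.rpow_div_two_eq_sqrt _ h0, Real.rpow_natCast, one_pow,
    add_comm]

/-- Test functions on the hyperboloid are dominated on a ball, uniformly in `ε`. -/
lemma tendsto_integral_hyperboloid {w : SpaceTime → ℝ} (c : ℝ) (hw : Continuous w)
    (hs : HasCompactSupport w) {k : ℝ → Space → ℝ} (hk : ∀ ε, Measurable (k ε))
    (hb : ∀ ε, ∀ y ≠ 0, |k ε y| ≤ ‖y‖⁻¹) (hcont : ∀ y ≠ 0, ContinuousAt (fun ε => k ε y) 0) :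
    Tendsto (fun ε => ∫ y, w (hyperboloid c ε y) * k ε y) (𝓝 0)
      (𝓝 (∫ y, w (cone c y) * k 0 y)) := by
  obtain ⟨M, hM⟩ := hw.bounded_above_of_compact_support hs
  obtain ⟨R, hR⟩ := hs.isCompact.isBounded.exists_norm_le
  have h0 : ∀ ε y, R < ‖y‖ → w (hyperboloid c ε y) = 0 := by
    intro ε y hy
    by_contra hne
    have h1 := hR _ (subset_tsupport _ hne)
    have h2 : ‖y‖ ≤ ‖hyperboloid c ε y‖ := norm_fst_le (hyperboloid c ε y)
    linarith
  have hM0 : 0 ≤ M := (norm_nonneg _).trans (hM 0)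
  have hint : Integrable ((Metric.closedBall (0 : Space) R).indicator fun y => M * ‖y‖⁻¹) :=
    IntegrableOn.integrable_indicator
      ((locallyIntegrable_inv_norm.integrableOn_isCompact (isCompact_closedBall 0 R)).const_mul M)
      Metric.isClosed_closedBall.measurableSet
  refine tendsto_integral_filter_of_dominated_convergence _ ?_ ?_ hint ?_
  · exact Eventually.of_forall fun ε =>
      ((hw.comp (continuous_hyperboloid c ε)).measurable.mul (hk ε)).aestronglyMeasurable
  · refine Eventually.of_forall fun ε => ?_
    filter_upwards [Measure.ae_ne volume (0 : Space)] with y hy0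
    by_cases hy : ‖y‖ ≤ R
    · rw [indicator_of_mem (by simpa using hy), norm_mul]
      exact mul_le_mul (hM _) (hb ε y hy0) (norm_nonneg _) hM0
    · rw [indicator_of_notMem (by simpa using hy), h0 ε y (not_le.1 hy)]
      simp
  · filter_upwards [Measure.ae_ne volume (0 : Space)] with y hy
    have h1 : ContinuousAt (fun ε => w (hyperboloid c ε y) * k ε y) 0 := by
      refine ContinuousAt.mul ?_ (hcont y hy)
      have : Continuous fun ε : ℝ => w (hyperboloid c ε y) := by
        refine hw.comp ?_
        unfold hyperboloid regNorm
        fun_prop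
      exact this.continuousAt
    have := h1.tendsto
    rwa [hyperboloid_zero] at this

/-- After rescaling, the argument of w shrinks to the origin while the weight stays fixed and
integrable: the error terms act as approximate deltas. -/
lemma tendsto_integral_dilation {w : SpaceTime → ℝ} (c : ℝ) (hw : Continuous w)
    (hs : HasCompactSupport w) {g : Space → ℝ} (hg : Integrable g) :
    Tendsto (fun ε : ℝ => ∫ z, w (ε • hyperboloid c 1 z) * g z) (𝓝 0)
      (𝓝 (w 0 * ∫ z, g z)) := by
  obtain ⟨M, hM⟩ := hw.bounded_above_of_compact_support hs
  rw [← integral_const_mul]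
  refine tendsto_integral_filter_of_dominated_convergence (fun z => M * ‖g z‖) ?_ ?_
    (hg.norm.const_mul M) ?_
  · exact Eventually.of_forall fun ε =>
      ((by fun_prop : Continuous fun z => w (ε • hyperboloid c 1 z)).aestronglyMeasurable).mul
        hg.aestronglyMeasurable
  · refine Eventually.of_forall fun ε => Eventually.of_forall fun z => ?_
    rw [norm_mul]
    exact mul_le_mul_of_nonneg_right (hM _) (norm_nonneg _)
  · refine Eventually.of_forall fun z => ?_
    have : Continuous fun ε : ℝ => w (ε • hyperboloid c 1 z) * g z := by fun_prop
    simpa using this.tendsto 0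

/-- Substitute y = εz; the ε⁵ is ε² times the Jacobian ε³. For k = 0 a factor ε remains and the term
dies; for k = 1 the powers balance and it survives. -/
lemma integral_hyperboloid_eq_dilation {w : SpaceTime → ℝ} (c : ℝ) {ε : ℝ} (hε : 0 < ε) (k : ℕ) :
    ∫ y, ε ^ 2 * w (hyperboloid c ε y) * (regNorm ε y ^ (k + 4))⁻¹ =
      (ε ^ 5 * (ε ^ (k + 4))⁻¹) * ∫ z, w (ε • hyperboloid c 1 z) * (regNorm 1 z ^ (k + 4))⁻¹ := by
  have h := Measure.integral_comp_smul (volume : Measure Space)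
    (fun y => ε ^ 2 * w (hyperboloid c ε y) * (regNorm ε y ^ (k + 4))⁻¹) ε
  simp only [finrank_euclideanSpace, Fintype.card_fin, smul_eq_mul,
    abs_of_pos (inv_pos.2 (pow_pos hε 3))] at h
  rw [eq_comm, inv_mul_eq_iff_eq_mul₀ (pow_pos hε 3).ne'] at h
  rw [h, ← integral_const_mul, ← integral_const_mul]
  congr 1 with z
  rw [hyperboloid_smul hε, regNorm_smul hε, mul_pow]
  have := regNorm_pos one_pos z
  field_simp

/-- The retarded potential `δ(t - |x| / c) / (4 π c² |x|)` is a fundamental solution. -/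
theorem integral_waveFun_cone {c : ℝ} (hc : 0 < c) {f : SpaceTime → ℝ} (hf : ContDiff ℝ ∞ f)
    (hs : HasCompactSupport f) : ∫ y, waveFun c f (cone c y) ∂(newtonMeasure c) = f 0 := by
  have hft := contDiff_dirDeriv hf eTime
  have hst := hasCompactSupport_dirDeriv hs eTime
  have hftt := contDiff_dirDeriv hft eTime
  have hstt := hasCompactSupport_dirDeriv hst eTime
  have hW := contDiff_waveFun (c := c) hf
  have hWs : HasCompactSupport (waveFun c f) := by
    have h : ∀ i, HasCompactSupport (dirDeriv (eSpace i) (dirDeriv (eSpace i) f)) := fun i =>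
      hasCompactSupport_dirDeriv (hasCompactSupport_dirDeriv hs _) _
    unfold waveFun
    simp only [Fin.sum_univ_three]
    exact hstt.sub (((h 0).add (h 1)).add (h 2)).mul_left
  have hball : ∀ ε > 0, ∀ {w : SpaceTime → ℝ}, Continuous w → HasCompactSupport w →
      ∀ g : Space → ℝ, Continuous g → Integrable fun y => w (hyperboloid c ε y) * g y :=
    fun ε hε w hw hws g hg => ((hw.comp (continuous_hyperboloid c ε)).mul hg)
      |>.integrable_of_hasCompactSupport (hasCompactSupport_comp_hyperboloid hws c ε).mul_right
  have hinv : ∀ ε > 0, ∀ k : ℕ, Continuous fun y => (regNorm ε y ^ k)⁻¹ := fun ε hε k =>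
    ((continuous_regNorm ε).pow k).inv₀ fun y => (pow_pos (regNorm_pos hε y) k).ne'
  have main : ∀ ε > 0, (∫ y, waveFun c f (hyperboloid c ε y) * (regNorm ε y)⁻¹) =
      (∫ y, dirDeriv eTime (dirDeriv eTime f) (hyperboloid c ε y) * (ε ^ 2 * (regNorm ε y ^ 3)⁻¹))
      - 3 * c * (ε * ∫ z, dirDeriv eTime f (ε • hyperboloid c 1 z) * (regNorm 1 z ^ 4)⁻¹)
      + 3 * c ^ 2 * ∫ z, f (ε • hyperboloid c 1 z) * (regNorm 1 z ^ 5)⁻¹ := by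
    intro ε hε
    have e1 := integral_hyperboloid_eq_dilation (w := dirDeriv eTime f) c hε 0
    have e2 := integral_hyperboloid_eq_dilation (w := f) c hε 1
    have hε4 : ε ^ 5 * (ε ^ 4)⁻¹ = ε := by field_simp
    have hε5 : ε ^ 5 * (ε ^ 5)⁻¹ = 1 := by field_simp
    norm_num only [hε4, hε5, one_mul] at e1 e2
    have hsum :
        ∫ y, ∑ i : Fin 3, dirDeriv (EuclideanSpace.single i 1) (waveField c ε f i) y = 0 := by
      rw [integral_finsetSum]
      · exact Finset.sum_eq_zero fun i _ => integral_dirDeriv_eq_zero volume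
          (contDiff_waveField hε hf i) (hasCompactSupport_waveField hs i) _
      · exact fun i _ => (contDiff_dirDeriv (contDiff_waveField hε hf i)
          _).continuous.integrable_of_hasCompactSupport
          (hasCompactSupport_dirDeriv (hasCompactSupport_waveField hs i) _)
    have i1 : Integrable fun y => waveFun c f (hyperboloid c ε y) * (regNorm ε y)⁻¹ :=
      hball ε hε hW.continuous hWs _ (by simpa using hinv ε hε 1)
    have i2 : Integrable fun y => dirDeriv eTime (dirDeriv eTime f) (hyperboloid c ε y) *
        (ε ^ 2 * (regNorm ε y ^ 3)⁻¹) :=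
      hball ε hε hftt.continuous hstt _ (continuous_const.mul (hinv ε hε 3))
    have i3 : Integrable fun y => 3 * c *
        (ε ^ 2 * dirDeriv eTime f (hyperboloid c ε y) * (regNorm ε y ^ 4)⁻¹) := by
      simpa only [mul_assoc] using
        ((hball ε hε hft.continuous hst _ (hinv ε hε 4)).const_mul (ε ^ 2)).const_mul (3 * c)
    have i4 : Integrable fun y => 3 * c ^ 2 *
        (ε ^ 2 * f (hyperboloid c ε y) * (regNorm ε y ^ 5)⁻¹) := by
      refine (((hball ε hε hf.continuous hs _ (hinv ε hε 5)).const_mul (ε ^ 2)).const_mul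
        (3 * c ^ 2)).congr (Eventually.of_forall fun y => ?_)
      simp only [mul_assoc]
    simp only [sum_dirDeriv_waveField hc hε hf] at hsum
    rw [integral_sub (by exact (i1.sub i2).add i3) i4,
      integral_add (by exact i1.sub i2) i3, integral_sub i1 i2, integral_const_mul,
      integral_const_mul, e1, e2] at hsum
    linarith
  have hle : ∀ ε, ∀ y : Space, y ≠ 0 → (regNorm ε y)⁻¹ ≤ ‖y‖⁻¹ := fun ε y hy =>
    inv_anti₀ (norm_pos_iff.2 hy) (norm_le_regNorm ε y)
  have hnn : ∀ ε y, 0 ≤ regNorm ε y := fun ε y => Real.sqrt_nonneg _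
  have hcont : ∀ y : Space, Continuous fun ε => regNorm ε y := fun y => by
    unfold regNorm; fun_prop
  have l1 := tendsto_integral_hyperboloid c hW.continuous hWs (k := fun ε y => (regNorm ε y)⁻¹)
    (fun ε => (continuous_regNorm ε).measurable.inv)
    (fun ε y hy => by
      rw [abs_of_nonneg (inv_nonneg.2 (hnn ε y))]
      exact hle ε y hy)
    (fun y hy => (hcont y).continuousAt.inv₀ (by simpa [regNorm_zero] using hy))
  -- This error has only ρ⁻³, which is not integrable at infinity after rescaling. Instead ε²ρ⁻³ ≤
  -- ρ⁻¹ ≤ |y|⁻¹ gives domination, and the kernel vanishes at ε = 0.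
  have l2 := tendsto_integral_hyperboloid c hftt.continuous hstt
    (k := fun ε y => ε ^ 2 * (regNorm ε y ^ 3)⁻¹)
    (fun ε => (((continuous_regNorm ε).measurable.pow_const 3).inv).const_mul _)
    (fun ε y hy => by
      have h1 : 0 < regNorm ε y := (norm_pos_iff.2 hy).trans_le (norm_le_regNorm ε y)
      rw [abs_of_nonneg (by positivity)]
      refine le_trans ?_ (hle ε y hy)
      have h2 : ε ^ 2 ≤ regNorm ε y ^ 2 := by rw [regNorm_sq]; nlinarith [norm_nonneg y]
      rw [← div_eq_mul_inv, div_le_iff₀ (by positivity)]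
      calc ε ^ 2 ≤ regNorm ε y ^ 2 := h2
        _ = (regNorm ε y)⁻¹ * regNorm ε y ^ 3 := by field_simp)
    (fun y hy => (by fun_prop : ContinuousAt (fun ε : ℝ => ε ^ 2) 0).mul
      (((hcont y).pow 3).continuousAt.inv₀ (by simpa [regNorm_zero] using hy)))
  have l3 := tendsto_integral_dilation c hft.continuous hst (integrable_inv_regNorm_pow (k := 4)
    (by norm_num))
  have l4 := tendsto_integral_dilation c hf.continuous hs (integrable_inv_regNorm_pow (k := 5)
    (by norm_num))
  rw [integral_inv_regNorm_pow_five] at l4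
  have lr := (l2.sub ((tendsto_id.mul l3).const_mul (3 * c))).add (l4.const_mul (3 * c ^ 2))
  -- The divergence identity `main` holds for ε > 0 only, so the limits are compared along ε → 0⁺.
  have hne : (𝓝[>] (0 : ℝ)).NeBot := inferInstance
  have heq := tendsto_nhds_unique (l1.mono_left (nhdsWithin_le_nhds (s := Ioi 0)))
    ((lr.mono_left (nhdsWithin_le_nhds (s := Ioi 0))).congr' (by
      filter_upwards [self_mem_nhdsWithin] with ε hε
      exact (main ε hε).symm))
  rw [integral_newtonMeasure]
  have hmul : ∀ y, newton c y * waveFun c f (cone c y) =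
      (4 * Real.pi * c ^ 2)⁻¹ * (waveFun c f (cone c y) * (regNorm 0 y)⁻¹) := by
    intro y
    rw [newton, regNorm_zero, mul_inv]
    ring
  simp only [hmul]
  rw [integral_const_mul, heq]
  simp only [ne_eq, OfNat.ofNat_ne_zero, not_false_eq_true, zero_pow, zero_mul, mul_zero,
    integral_zero, sub_zero, zero_add]
  have := Real.pi_pos
  field_simp

/-! ### Uniqueness for the Cauchy problem -/

/-- The solution of the wave equation with source `f` which vanishes in the distant future. -/
def advancedPotential (c : ℝ) (f : SpaceTime → ℝ) (p : SpaceTime) : ℝ :=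
  ∫ y, f (p + cone c y) ∂(newtonMeasure c)

lemma norm_le_norm_cone (c : ℝ) (y : Space) : ‖y‖ ≤ ‖cone c y‖ := norm_fst_le (cone c y)

instance (c : ℝ) : IsLocallyFiniteMeasure ((newtonMeasure c).map fun y => -cone c y) :=
  isLocallyFiniteMeasure_map (continuous_cone c).neg.measurable
    fun R => ⟨R, fun y hy => (norm_le_norm_cone c y).trans (by simpa using hy)⟩

section

variable {c : ℝ} {f : SpaceTime → ℝ}

/-- The potential is the convolution of f with the reflected cone measure, so it inherits the
smoothness of f. -/
lemma contDiff_advancedPotential (hf : ContDiff ℝ ∞ f) (hs : HasCompactSupport f) :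
    ContDiff ℝ ∞ (advancedPotential c f) := by
  have h : advancedPotential c f =
      (fun _ => (1 : ℝ)) ⋆[ContinuousLinearMap.mul ℝ ℝ,
        (newtonMeasure c).map fun y => -cone c y] f := by
    ext p
    have hm : Measurable fun y => -cone c y := (continuous_cone c).neg.measurable
    rw [convolution_def, integral_map hm.aemeasurable
      (by
        simp only [ContinuousLinearMap.mul_apply', one_mul]
        exact (hf.continuous.comp (continuous_sub_left p)).aestronglyMeasurable)]
    simp [advancedPotential]
  rw [h]
  exact hs.contDiff_convolution_right _ (locallyIntegrable_const 1) hf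

lemma integrable_comp_cone (hf : Continuous f) (hs : HasCompactSupport f) (p : SpaceTime) :
    Integrable (fun y => f (p + cone c y)) (newtonMeasure c) := by
  refine (hf.comp (continuous_const.add (continuous_cone c))).integrable_of_hasCompactSupport ?_
  obtain ⟨R, hR⟩ := hs.isCompact.isBounded.exists_norm_le
  refine HasCompactSupport.intro (isCompact_closedBall (0 : Space) (R + ‖p‖)) fun y hy => ?_
  by_contra hne
  have h1 : ‖p + cone c y‖ ≤ R := hR _ (subset_tsupport _ hne)
  have h2 := norm_sub_le (p + cone c y) p
  have h3 := norm_le_norm_cone c y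
  simp at h2 hy
  linarith

lemma dirDeriv_advancedPotential (hf : ContDiff ℝ ∞ f) (hs : HasCompactSupport f) (v : SpaceTime) :
    dirDeriv v (advancedPotential c f) = advancedPotential c (dirDeriv v f) := by
  ext p
  have hg := contDiff_dirDeriv hf v
  have hgs := hasCompactSupport_dirDeriv hs v
  obtain ⟨M, hM⟩ := hg.continuous.bounded_above_of_compact_support hgs
  obtain ⟨R, hR⟩ := hgs.isCompact.isBounded.exists_norm_le
  have h0 : HasLineDerivAt ℝ (advancedPotential c f) (dirDeriv v (advancedPotential c f) p) p v :=
    (((contDiff_advancedPotential hf hs).differentiable (by simp)) p).hasFDerivAt.hasLineDerivAt v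
  have hbound : Integrable ((Metric.closedBall (0 : Space) (R + ‖p‖ + ‖v‖)).indicator fun _ => M)
      (newtonMeasure c) := by
    refine IntegrableOn.integrable_indicator ?_ Metric.isClosed_closedBall.measurableSet
    exact integrableOn_const (isCompact_closedBall _ _).measure_lt_top.ne
  have h1 := hasDerivAt_integral_of_dominated_loc_of_deriv_le (μ := newtonMeasure c)
    (F := fun (s : ℝ) y => f (p + s • v + cone c y))
    (F' := fun (s : ℝ) y => dirDeriv v f (p + s • v + cone c y)) (x₀ := (0 : ℝ))
    (bound := (Metric.closedBall (0 : Space) (R + ‖p‖ + ‖v‖)).indicator fun _ => M)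
    (s := Metric.ball 0 1) (Metric.ball_mem_nhds 0 one_pos)
    (Eventually.of_forall fun s => (integrable_comp_cone hf.continuous hs _).aestronglyMeasurable)
    (integrable_comp_cone hf.continuous hs _)
    (integrable_comp_cone hg.continuous hgs _).aestronglyMeasurable
    (Eventually.of_forall fun y s hsm => ?_) hbound (Eventually.of_forall fun y s _ => ?_)
  · have h2 := HasDerivAt.unique h0 h1.2
    rw [h2]
    simp [advancedPotential]
  · by_cases hy : ‖y‖ ≤ R + ‖p‖ + ‖v‖
    · rw [indicator_of_mem (by simpa using hy)]
      exact hM _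
    · rw [indicator_of_notMem (by simpa using hy), norm_le_zero_iff]
      by_contra hne
      have h1 := hR _ (subset_tsupport _ hne)
      have h3 := norm_le_norm_cone c y
      have h4 : ‖s • v‖ ≤ ‖v‖ := by
        rw [norm_smul]
        have : ‖s‖ < 1 := by simpa using hsm
        nlinarith [norm_nonneg v]
      have h5 := norm_sub_le (p + s • v + cone c y) (p + s • v)
      have h6 := norm_add_le p (s • v)
      rw [add_sub_cancel_left] at h5
      linarith
  · have h2 : HasDerivAt (fun s : ℝ => p + s • v + cone c y) v s := by
      simpa using (((hasDerivAt_id s).smul_const v).const_add p).add_const (cone c y)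
    exact ((hf.differentiable (by simp)) _).hasFDerivAt.comp_hasDerivAt s h2

lemma dirDeriv_comp_add_left {E : Type*} [NormedAddCommGroup E] [NormedSpace ℝ E] (v : E)
    (g : E → ℝ) (p : E) :
    dirDeriv v (fun q => g (p + q)) = fun q => dirDeriv v g (p + q) := by
  ext q
  simp [dirDeriv, fderiv_comp_add_left]

lemma waveFun_comp_add_left (c : ℝ) (g : SpaceTime → ℝ) (p : SpaceTime) :
    waveFun c (fun q => g (p + q)) = fun q => waveFun c g (p + q) := by
  ext q
  simp only [waveFun, dirDeriv_comp_add_left]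

lemma integral_waveFun_add_cone (hc : 0 < c) (hf : ContDiff ℝ ∞ f) (hs : HasCompactSupport f)
    (p : SpaceTime) : ∫ y, waveFun c f (p + cone c y) ∂(newtonMeasure c) = f p := by
  have h := integral_waveFun_cone hc (f := fun q => f (p + q))
    (hf.comp (contDiff_const.add contDiff_id)) (hs.comp_homeomorph (Homeomorph.addLeft p))
  rw [waveFun_comp_add_left] at h
  simpa using h

/-- Derivatives pass under the integral onto f, and the translated fundamental-solution identity
then returns f. -/
lemma waveFun_advancedPotential (hc : 0 < c) (hf : ContDiff ℝ ∞ f) (hs : HasCompactSupport f) :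
    waveFun c (advancedPotential c f) = f := by
  ext p
  rw [← integral_waveFun_add_cone hc hf hs p]
  have hi : ∀ v : SpaceTime, Integrable (fun y => dirDeriv v (dirDeriv v f) (p + cone c y))
      (newtonMeasure c) := fun v =>
    integrable_comp_cone (contDiff_dirDeriv (contDiff_dirDeriv hf v) v).continuous
      (hasCompactSupport_dirDeriv (hasCompactSupport_dirDeriv hs v) v) p
  simp only [waveFun]
  rw [integral_sub (hi _) ((integrable_finsetSum _ fun i _ => hi _).const_mul _),
    integral_const_mul, integral_finsetSum _ fun i _ => hi _]
  simp only [dirDeriv_advancedPotential hf hs, dirDeriv_advancedPotential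
    (contDiff_dirDeriv hf _) (hasCompactSupport_dirDeriv hs _), advancedPotential]

lemma dirDeriv_eventuallyEq {E : Type*} [NormedAddCommGroup E] [NormedSpace ℝ E] {g h : E → ℝ}
    {p : E} (hgh : g =ᶠ[𝓝 p] h) (v : E) : dirDeriv v g =ᶠ[𝓝 p] dirDeriv v h := by
  filter_upwards [hgh.fderiv (𝕜 := ℝ)] with q hq
  simp [dirDeriv, hq]

lemma waveFun_congr {g h : SpaceTime → ℝ} {p : SpaceTime} (hgh : g =ᶠ[𝓝 p] h) :
    waveFun c g p = waveFun c h p := by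
  simp only [waveFun]
  rw [(dirDeriv_eventuallyEq (dirDeriv_eventuallyEq hgh _) _).eq_of_nhds]
  congr 2
  exact Finset.sum_congr rfl fun i _ =>
    (dirDeriv_eventuallyEq (dirDeriv_eventuallyEq hgh _) _).eq_of_nhds

/-- The advanced potential of a source, cut off for `t < -2`. -/
def cutPotential (c : ℝ) (f : SpaceTime → ℝ) (p : SpaceTime) : ℝ :=
  Real.smoothTransition (p.2 + 2) * advancedPotential c f p

lemma contDiff_cutPotential (hf : ContDiff ℝ ∞ f) (hs : HasCompactSupport f) :
    ContDiff ℝ ∞ (cutPotential c f) :=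
  (Real.smoothTransition.contDiff.comp (contDiff_snd.add contDiff_const)).mul
    (contDiff_advancedPotential hf hs)

lemma hasCompactSupport_cutPotential (hc : 0 < c) (hs : HasCompactSupport f) :
    HasCompactSupport (cutPotential c f) := by
  obtain ⟨R, hR⟩ := hs.isCompact.isBounded.exists_norm_le
  -- Where the cut potential is nonzero, t > −2 and some p + `cone c y` lies in the ball of radius
  -- R. Then t + |y|/c ≤ R gives |y| ≤ c(R + 2), which bounds the space component by R + c(R + 2).
  refine HasCompactSupport.intro
    ((isCompact_closedBall (0 : Space) (R + c * (R + 2))).prod (isCompact_Icc (a := -2) (b := R)))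
    fun p hp => ?_
  rw [cutPotential, mul_eq_zero, or_iff_not_imp_left]
  intro hne
  have ht : -2 < p.2 := by
    by_contra! hle
    exact hne (Real.smoothTransition.zero_of_nonpos (by linarith))
  refine integral_eq_zero_of_ae (Eventually.of_forall fun y => ?_)
  by_contra hy
  apply hp
  have h1 := hR _ (subset_tsupport _ hy)
  have h2 : ‖p.1 + y‖ ≤ R := (norm_fst_le (p + cone c y)).trans h1
  have h3 : |p.2 + ‖y‖ / c| ≤ R := (norm_snd_le (p + cone c y)).trans h1
  have h4 := (abs_le.1 h3).2
  have h5 : 0 ≤ ‖y‖ / c := by positivity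
  have h6 : ‖y‖ / c ≤ R + 2 := by linarith
  rw [div_le_iff₀ hc] at h6
  have h7 := norm_sub_le (p.1 + y) y
  rw [add_sub_cancel_right] at h7
  refine ⟨?_, ?_, ?_⟩
  · simp only [Metric.mem_closedBall, dist_zero_right]
    linarith
  · exact ht.le
  · linarith

end

/-- Write Φ as the wave operator applied to Θ plus a remainder living in the past: U kills the first
by the equation and the second by its vanishing there. -/
lemma eq_zero_of_waveOp_eq_zero {c : ℝ} (hc : 0 < c) {U : 𝓓'((⊤ : Opens SpaceTime), ℝ)}
    (h0 : ∀ Φ : 𝓓((⊤ : Opens SpaceTime), ℝ), tsupport Φ ⊆ {p | p.2 < 0} → U Φ = 0)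
    (hU : ∀ Φ, waveOp c U Φ = 0) (Φ : 𝓓((⊤ : Opens SpaceTime), ℝ)) : U Φ = 0 := by
  let Θ : 𝓓((⊤ : Opens SpaceTime), ℝ) :=
    ⟨cutPotential c Φ, contDiff_cutPotential Φ.contDiff Φ.hasCompactSupport,
      hasCompactSupport_cutPotential hc Φ.hasCompactSupport, by simp⟩
  have h1 : U (waveTest c Θ) = 0 := by rw [← waveOp_apply]; exact hU Θ
  have h2 : U (Φ - waveTest c Θ) = 0 := by
    refine h0 _ ?_
    -- The cut-off equals 1 for t ≥ −1, so the remainder vanishes for t > −1. The margin keeps its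
    -- closed support strictly inside t < 0.
    have hcl : IsClosed {p : SpaceTime | p.2 ≤ -1} := isClosed_le continuous_snd continuous_const
    refine (closure_minimal ?_ hcl).trans fun p (hp : p.2 ≤ -1) => ?_
    · intro p hp
      by_contra hlt
      have hlt' : -1 < p.2 := not_le.1 hlt
      refine hp ?_
      have hev : cutPotential c Φ =ᶠ[𝓝 p] advancedPotential c Φ := by
        filter_upwards [(isOpen_lt continuous_const continuous_snd).mem_nhds hlt'] with q hq
        have hq' : -1 < q.2 := hq
        rw [cutPotential, Real.smoothTransition.one_of_one_le (by linarith), one_mul]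
      have hw : waveTest c Θ p = Φ p := by
        rw [coe_waveTest]
        change waveFun c (cutPotential c Φ) p = Φ p
        rw [waveFun_congr hev, waveFun_advancedPotential hc Φ.contDiff Φ.hasCompactSupport]
      change Φ p - waveTest c Θ p = 0
      rw [hw, sub_self]
    · change p.2 < 0
      linarith
  have h3 : U Φ = U (waveTest c Θ) + U (Φ - waveTest c Θ) := by
    rw [← map_add]; simp
  rw [h3, h1, h2, add_zero]

theorem IsSolution.unique {c : ℝ} (hc : 0 < c) {f g : Space → ℝ}
    {U V : 𝓓'((⊤ : Opens SpaceTime), ℝ)} (hU : IsSolution c f g U) (hV : IsSolution c f g V) :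
    U = V := by
  ext Φ
  rw [← sub_eq_zero]
  refine eq_zero_of_waveOp_eq_zero (U := U - V) hc (fun Ψ hΨ => ?_) (fun Ψ => ?_) Φ
  · change U Ψ - V Ψ = 0
    rw [hU.vanishes_past Ψ hΨ, hV.vanishes_past Ψ hΨ, sub_self]
  · rw [waveOp_apply]
    change U (waveTest c Ψ) - V (waveTest c Ψ) = 0
    rw [← waveOp_apply, ← waveOp_apply, hU.weak_eq, hV.weak_eq, sub_self]

/-! ### Values at points -/

lemma slice_apply (Φ : 𝓓((⊤ : Opens SpaceTime), ℝ)) (x : Space) (t : ℝ) :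
    slice Φ x t = Φ (x, t) := rfl

/-- Testing against products a(x)φ(t) determines the values for almost every x, and weak continuity
then for every x. -/
theorem IsValueAtPoints.unique {U : 𝓓'((⊤ : Opens SpaceTime), ℝ)}
    {u v : Space → 𝓓'((⊤ : Opens ℝ), ℝ)} (hu : IsValueAtPoints U u) (hv : IsValueAtPoints U v) :
    u = v := by
  suffices h : ∀ φ : 𝓓((⊤ : Opens ℝ), ℝ), (fun x => u x φ - v x φ) = fun _ => 0 by
    ext x φ
    exact sub_eq_zero.1 (congrFun (h φ) x)
  intro φ
  have hc : Continuous fun x => u x φ - v x φ := (hu.continuous φ).sub (hv.continuous φ)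
  refine ((hc.ae_eq_iff_eq volume continuous_const).1 ?_)
  refine ae_eq_zero_of_integral_contDiff_smul_eq_zero hc.locallyIntegrable fun a ha has => ?_
  let Φ : 𝓓((⊤ : Opens SpaceTime), ℝ) :=
    ⟨fun p => a p.1 * φ p.2, (ha.comp contDiff_fst).mul (φ.contDiff.comp contDiff_snd), by
      refine HasCompactSupport.intro (has.isCompact.prod φ.hasCompactSupport.isCompact) ?_
      rintro ⟨x, t⟩ hp
      rw [mem_prod, not_and_or] at hp
      rcases hp with h | h
      · simp [image_eq_zero_of_notMem_tsupport h]
      · simp [image_eq_zero_of_notMem_tsupport h], by simp⟩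
  have hΦ : ∀ x, slice Φ x = a x • φ := fun x => by
    ext t
    rfl
  have hint : ∀ w : Space → 𝓓'((⊤ : Opens ℝ), ℝ), (∀ φ, Continuous fun x => w x φ) →
      Integrable fun x => a x * w x φ := fun w hw =>
    (ha.continuous.mul (hw φ)).integrable_of_hasCompactSupport has.mul_right
  have h1 := hu.disintegration Φ
  rw [hv.disintegration Φ] at h1
  simp only [hΦ, map_smul, smul_eq_mul] at h1
  simp only [smul_eq_mul, mul_sub]
  rw [integral_sub (hint u hu.continuous) (hint v hv.continuous), h1, sub_self]

lemma slice_neg_lineDerivOp (Φ : 𝓓((⊤ : Opens SpaceTime), ℝ)) (x : Space) :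
    slice (-∂_{eTime} Φ) x = -∂_{(1 : ℝ)} (slice Φ x) := by
  ext t
  change -(∂_{eTime} Φ : 𝓓((⊤ : Opens SpaceTime), ℝ)) (x, t)
    = -(∂_{(1 : ℝ)} (slice Φ x) : 𝓓((⊤ : Opens ℝ), ℝ)) t
  rw [lineDerivOp_testFunction_apply, lineDerivOp_testFunction_apply, neg_inj]
  have h1 : HasFDerivAt Φ (fderiv ℝ Φ (x, t)) (x, t) :=
    ((Φ.contDiff.differentiable (by simp)) (x, t)).hasFDerivAt
  have h2 : HasDerivAt (fun s : ℝ => ((x, s) : SpaceTime)) eTime t :=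
    (hasDerivAt_const t x).prodMk (hasDerivAt_id t)
  have h3 : HasDerivAt (slice Φ x) (dirDeriv eTime Φ (x, t)) t := h1.comp_hasDerivAt t h2
  change _ = fderiv ℝ (slice Φ x) t 1
  rw [fderiv_apply_one_eq_deriv, h3.deriv]

theorem IsValueAtPoints.timeDeriv {U : 𝓓'((⊤ : Opens SpaceTime), ℝ)}
    {u : Space → 𝓓'((⊤ : Opens ℝ), ℝ)} (hu : IsValueAtPoints U u) :
    IsValueAtPoints (∂_{eTime} U) fun x => ∂_{(1 : ℝ)} (u x) where
  continuous φ := by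
    simp only [Distribution.lineDerivOp_apply_apply]
    exact hu.continuous _
  disintegration Φ := by
    simp only [Distribution.lineDerivOp_apply_apply, ← slice_neg_lineDerivOp]
    exact hu.disintegration _

lemma lineDerivOp_comm {E : Type*} [NormedAddCommGroup E] [NormedSpace ℝ E]
    (Φ : 𝓓((⊤ : Opens E), ℝ)) (v w : E) : ∂_{v} (∂_{w} Φ) = ∂_{w} (∂_{v} Φ) := by
  ext p
  simp only [lineDerivOp_testFunction_apply]
  exact dirDeriv_comm Φ.contDiff v w p

lemma lineDerivOp_waveTest (c : ℝ) (Φ : 𝓓((⊤ : Opens SpaceTime), ℝ)) (v : SpaceTime) :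
    ∂_{v} (waveTest c Φ) = waveTest c (∂_{v} Φ) := by
  have h : ∀ w : SpaceTime, ∂_{v} (∂_{w} (∂_{w} Φ)) = ∂_{w} (∂_{w} (∂_{v} Φ)) := fun w => by
    rw [lineDerivOp_comm, lineDerivOp_comm Φ v w]
  rw [waveTest, TestFunction.lineDerivOp_eq_lineDerivCLM ℝ (v := v)]
  simp only [map_sub, map_smul, map_sum]
  simp only [← TestFunction.lineDerivOp_eq_lineDerivCLM ℝ, h, waveTest]

/-- The wave operator commutes with ∂ₜ, which turns the source g δ(t) into g δ'(t). -/
theorem IsSolution.timeDeriv {c : ℝ} {g : Space → ℝ} {U : 𝓓'((⊤ : Opens SpaceTime), ℝ)}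
    (hU : IsSolution c (fun _ => 0) g U) : IsSolution c g (fun _ => 0) (∂_{eTime} U) where
  vanishes_past Φ hΦ := by
    rw [Distribution.lineDerivOp_apply_apply, map_neg, neg_eq_zero]
    refine hU.vanishes_past _ (subset_trans ?_ hΦ)
    rw [lineDerivOp_testFunction_apply]
    exact closure_minimal ((support_fderiv_subset ℝ).trans' fun p hp hz => hp (by
      simp [dirDeriv, hz])) isClosed_closure
  weak_eq Φ := by
    rw [waveOp_apply, Distribution.lineDerivOp_apply_apply, map_neg, lineDerivOp_waveTest,
      ← waveOp_apply, hU.weak_eq]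
    simp

/-! ### The solution with data `(0, χ)` -/

/-- The value at `x` of the solution with data `(0, χ)`, as a measure in time. -/
def sliceMeasure (c r : ℝ) (x₀ x : Space) : Measure ℝ :=
  ((newtonMeasure c).restrict (Metric.closedBall (x - x₀) r)).map fun y => ‖y‖ / c

instance (c r : ℝ) (x₀ x : Space) : IsFiniteMeasure (sliceMeasure c r x₀ x) := by
  have : IsFiniteMeasure ((newtonMeasure c).restrict (Metric.closedBall (x - x₀) r)) :=
    ⟨by simpa using (isCompact_closedBall (x - x₀) r).measure_lt_top⟩
  unfold sliceMeasure
  infer_instance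

/-- The value at `x` of the solution with data `(0, χ)`. -/
def waveSlice (c r : ℝ) (x₀ x : Space) : 𝓓'((⊤ : Opens ℝ), ℝ) := ofMeasure (sliceMeasure c r x₀ x)

lemma mem_closedBall_sub_iff {x₀ x y : Space} {r : ℝ} :
    y ∈ Metric.closedBall (x - x₀) r ↔ x - y ∈ Metric.closedBall x₀ r := by
  simp only [Metric.mem_closedBall, dist_eq_norm]
  rw [← norm_neg, show -(y - (x - x₀)) = x - y - x₀ by abel]

lemma ballChar_sub_mul {x₀ x y : Space} {r a : ℝ} :
    ballChar x₀ r (x - y) * a = (Metric.closedBall (x - x₀) r).indicator (fun _ => a) y := by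
  by_cases h : x - y ∈ Metric.closedBall x₀ r
  · rw [ballChar, indicator_of_mem h, indicator_of_mem (mem_closedBall_sub_iff.2 h), one_mul]
  · rw [ballChar, indicator_of_notMem h, indicator_of_notMem (mt mem_closedBall_sub_iff.1 h),
      zero_mul]

lemma waveSlice_apply_setIntegral (c r : ℝ) (x₀ x : Space) (φ : 𝓓((⊤ : Opens ℝ), ℝ)) :
    waveSlice c r x₀ x φ =
      ∫ y in Metric.closedBall (x - x₀) r, φ (‖y‖ / c) ∂(newtonMeasure c) := by
  rw [waveSlice, ofMeasure_apply, sliceMeasure, integral_map (by fun_prop) (by fun_prop)]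

lemma waveSlice_apply (c r : ℝ) (x₀ x : Space) (φ : 𝓓((⊤ : Opens ℝ), ℝ)) :
    waveSlice c r x₀ x φ = ∫ y, ballChar x₀ r (x - y) * φ (‖y‖ / c) ∂(newtonMeasure c) := by
  rw [waveSlice_apply_setIntegral, ← integral_indicator Metric.isClosed_closedBall.measurableSet]
  simp only [ballChar_sub_mul]
  rfl

lemma measurable_ballChar (x₀ : Space) (r : ℝ) : Measurable (ballChar x₀ r) :=
  measurable_const.indicator Metric.isClosed_closedBall.measurableSet

lemma abs_ballChar_le (x₀ : Space) (r : ℝ) (x : Space) : |ballChar x₀ r x| ≤ 1 := by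
  unfold ballChar indicator
  split_ifs <;> simp

lemma continuousAt_ballChar {x₀ x : Space} {r : ℝ} (h : x ∉ Metric.sphere x₀ r) :
    ContinuousAt (ballChar x₀ r) x := by
  rcases lt_or_gt_of_ne (fun he => h (Metric.mem_sphere.2 he) : dist x x₀ ≠ r) with hlt | hgt
  · refine (continuousAt_const (y := (1 : ℝ))).congr ?_
    filter_upwards [Metric.isOpen_ball.mem_nhds (Metric.mem_ball.2 hlt)] with y hy
    rw [ballChar, indicator_of_mem (Metric.ball_subset_closedBall hy)]
  · refine (continuousAt_const (y := (0 : ℝ))).congr ?_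
    filter_upwards [Metric.isClosed_closedBall.isOpen_compl.mem_nhds
      (show x ∈ (Metric.closedBall x₀ r)ᶜ by simpa using hgt)] with y hy
    rw [ballChar, indicator_of_notMem hy]

/-- Dominated convergence: the moving indicator is discontinuous only on a sphere, which is a null
set. -/
lemma continuous_waveSlice {c : ℝ} (hc : 0 < c) (r : ℝ) (x₀ : Space) (φ : 𝓓((⊤ : Opens ℝ), ℝ)) :
    Continuous fun x => waveSlice c r x₀ x φ := by
  simp only [waveSlice_apply]
  have hφ : Continuous fun y : Space => φ (‖y‖ / c) := φ.continuous.comp (by fun_prop)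
  refine continuous_iff_continuousAt.2 fun x => continuousAt_of_dominated
    (bound := fun y => ‖φ (‖y‖ / c)‖) (Eventually.of_forall fun x' => ?_)
    (Eventually.of_forall fun x' => Eventually.of_forall fun y => ?_) ?_ ?_
  · exact (((measurable_ballChar x₀ r).comp (measurable_const.sub measurable_id)).mul
      hφ.measurable).aestronglyMeasurable
  · rw [norm_mul]
    exact mul_le_of_le_one_left (norm_nonneg _) (abs_ballChar_le _ _ _)
  · refine (hφ.integrable_of_hasCompactSupport ?_).norm
    obtain ⟨R, hR⟩ := φ.hasCompactSupport.isCompact.isBounded.exists_norm_le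
    refine HasCompactSupport.intro (isCompact_closedBall (0 : Space) (c * R)) fun y hy => ?_
    by_contra hne
    refine hy ?_
    have h1 := hR _ (subset_tsupport _ hne)
    rw [Real.norm_of_nonneg (by positivity), div_le_iff₀ hc] at h1
    simpa [mul_comm] using h1
  · have h0 : newtonMeasure c (Metric.sphere (x - x₀) r) = 0 :=
      newtonMeasure_absolutelyContinuous c (Measure.addHaar_sphere volume _ _)
    filter_upwards [compl_mem_ae_iff.2 h0] with y hy
    refine ContinuousAt.mul (ContinuousAt.comp (continuousAt_ballChar fun h => hy ?_)
      (by fun_prop)) continuousAt_const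
    simp only [mem_sphere_iff_norm] at h ⊢
    rw [← h, ← norm_neg]
    congr 1
    abel

/-- The solution with data `(0, χ)`, as a measure on space-time. -/
def waveMeasure (c r : ℝ) (x₀ : Space) : Measure SpaceTime :=
  (((newtonMeasure c).prod (volume : Measure Space)).restrict
    {q | q.2 - q.1 ∈ Metric.closedBall x₀ r}).map fun q => (q.2, ‖q.1‖ / c)

lemma isLocallyFiniteMeasure_waveMeasure {c : ℝ} (hc : 0 < c) (r : ℝ) (x₀ : Space) :
    IsLocallyFiniteMeasure (waveMeasure c r x₀) := by
  refine isLocallyFiniteMeasure_map (by fun_prop) fun R => ⟨max (R * c) R, fun q hq => ?_⟩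
  have h1 : ‖q.2‖ ≤ R := (norm_fst_le _).trans hq
  have h2 : ‖‖q.1‖ / c‖ ≤ R := (norm_snd_le _).trans hq
  rw [Real.norm_of_nonneg (by positivity), div_le_iff₀ hc] at h2
  exact max_le_max h2 h1

/-- The solution with data `(0, χ)`. -/
def waveDistribution (c r : ℝ) (x₀ : Space) : 𝓓'((⊤ : Opens SpaceTime), ℝ) :=
  ofMeasure (waveMeasure c r x₀)

lemma measurableSet_difference (x₀ : Space) (r : ℝ) :
    MeasurableSet {q : Space × Space | q.2 - q.1 ∈ Metric.closedBall x₀ r} :=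
  (Metric.isClosed_closedBall.preimage (by fun_prop : Continuous fun q : Space × Space =>
    q.2 - q.1)).measurableSet

lemma ballChar_mul_eq_indicator (x₀ : Space) (r : ℝ) (F : Space × Space → ℝ) :
    (fun q : Space × Space => ballChar x₀ r (q.2 - q.1) * F q) =
      {q : Space × Space | q.2 - q.1 ∈ Metric.closedBall x₀ r}.indicator F := by
  ext q
  by_cases h : q.2 - q.1 ∈ Metric.closedBall x₀ r
  · rw [indicator_of_mem (by exact h), ballChar, indicator_of_mem h, one_mul]
  · rw [indicator_of_notMem (by exact h), ballChar, indicator_of_notMem h, zero_mul]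

lemma integrable_ballChar_mul {c : ℝ} (hc : 0 < c) (r : ℝ) (x₀ : Space)
    (Φ : 𝓓((⊤ : Opens SpaceTime), ℝ)) :
    Integrable (fun q : Space × Space => ballChar x₀ r (q.2 - q.1) * Φ (q.2, ‖q.1‖ / c))
      ((newtonMeasure c).prod volume) := by
  have := isLocallyFiniteMeasure_waveMeasure hc r x₀
  have h : Integrable Φ (waveMeasure c r x₀) :=
    Φ.continuous.integrable_of_hasCompactSupport Φ.hasCompactSupport
  rw [waveMeasure, integrable_map_measure (by fun_prop) (by fun_prop)] at h
  rw [ballChar_mul_eq_indicator x₀ r fun q => Φ (q.2, ‖q.1‖ / c)]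
  exact IntegrableOn.integrable_indicator h (measurableSet_difference x₀ r)

lemma waveDistribution_apply {c : ℝ} (hc : 0 < c) (r : ℝ) (x₀ : Space)
    (Φ : 𝓓((⊤ : Opens SpaceTime), ℝ)) :
    waveDistribution c r x₀ Φ = ∫ q : Space × Space,
      ballChar x₀ r (q.2 - q.1) * Φ (q.2, ‖q.1‖ / c) ∂((newtonMeasure c).prod volume) := by
  have := isLocallyFiniteMeasure_waveMeasure hc r x₀
  rw [waveDistribution, ofMeasure_apply, waveMeasure, integral_map (by fun_prop) (by fun_prop),
    ballChar_mul_eq_indicator x₀ r fun q => Φ (q.2, ‖q.1‖ / c),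
    integral_indicator (measurableSet_difference x₀ r)]

theorem isValueAtPoints_waveDistribution {c : ℝ} (hc : 0 < c) (r : ℝ) (x₀ : Space) :
    IsValueAtPoints (waveDistribution c r x₀) (waveSlice c r x₀) where
  continuous φ := continuous_waveSlice hc r x₀ φ
  disintegration Φ := by
    rw [waveDistribution_apply hc, integral_prod_symm _ (integrable_ballChar_mul hc r x₀ Φ)]
    simp only [waveSlice_apply, slice_apply]

theorem isSolution_waveDistribution {c : ℝ} (hc : 0 < c) (r : ℝ) (x₀ : Space) :
    IsSolution c (fun _ => 0) (ballChar x₀ r) (waveDistribution c r x₀) where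
  vanishes_past Φ hΦ := by
    rw [waveDistribution_apply hc]
    refine integral_eq_zero_of_ae (Eventually.of_forall fun q => ?_)
    have h : ((q.2, ‖q.1‖ / c) : SpaceTime) ∉ tsupport Φ := fun hm => by
      have h1 : ‖q.1‖ / c < 0 := hΦ hm
      have : 0 ≤ ‖q.1‖ / c := by positivity
      linarith
    simp [image_eq_zero_of_notMem_tsupport h]
  weak_eq Φ := by
    have hi := integrable_ballChar_mul hc r x₀ (waveTest c Φ)
    -- The shear (y, x) ↦ (y, y + x) moves the translation from the indicator onto the test
    -- function, where the fundamental solution applies.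
    have hp := measurePreserving_prod_add (newtonMeasure c) (volume : Measure Space)
    have hi' := (hp.integrable_comp hi.aestronglyMeasurable).2 hi
    rw [waveOp_apply, waveDistribution_apply hc]
    nth_rewrite 1 [← hp.map_eq]
    rw [integral_map hp.measurable.aemeasurable (by rw [hp.map_eq]; exact hi.aestronglyMeasurable)]
    refine (integral_prod_symm _ hi').trans ?_
    simp only [zero_mul, integral_zero, sub_zero, Function.comp_apply]
    congr 1 with x
    simp only [add_sub_cancel_left]
    rw [integral_const_mul, coe_waveTest]
    congr 1
    rw [← integral_waveFun_add_cone hc Φ.contDiff Φ.hasCompactSupport (x, 0)]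
    simp [cone, add_comm]

/-! ### Archimedes' theorem on the area of spherical caps -/

/-- Substitute R = √(s² + ρ²), for which ρ dρ = R dR. -/
lemma lintegral_sqrt_substitution (s : ℝ) (g : ℝ → ENNReal) :
    ∫⁻ ρ in Ioi (0 : ℝ), ENNReal.ofReal ρ * g (√(s ^ 2 + ρ ^ 2)) =
      ∫⁻ R in Ioi |s|, ENNReal.ofReal R * g R := by
  have hpos : ∀ R ∈ Ioi |s|, 0 < R ^ 2 - s ^ 2 := fun R hR => by
    have h1 : |s| < R := hR
    have := abs_nonneg s
    rw [← sq_abs s]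
    nlinarith
  have himg : (fun R => √(R ^ 2 - s ^ 2)) '' Ioi |s| = Ioi 0 := by
    ext ρ
    constructor
    · rintro ⟨R, hR, rfl⟩
      exact Real.sqrt_pos.2 (hpos R hR)
    · intro hρ
      have hρ' : 0 < ρ := hρ
      refine ⟨√(s ^ 2 + ρ ^ 2), ?_, ?_⟩
      · refine Real.lt_sqrt_of_sq_lt ?_
        rw [sq_abs]
        nlinarith
      · simp only
        rw [Real.sq_sqrt (by positivity), add_sub_cancel_left, Real.sqrt_sq hρ'.le]
  have hd : ∀ R ∈ Ioi |s|, HasDerivWithinAt (fun R => √(R ^ 2 - s ^ 2))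
      (R / √(R ^ 2 - s ^ 2)) (Ioi |s|) R := fun R hR => by
    refine HasDerivAt.hasDerivWithinAt ((((hasDerivAt_pow 2 R).sub_const (s ^ 2)).sqrt
      (hpos R hR).ne').congr_deriv ?_)
    have := Real.sqrt_pos.2 (hpos R hR)
    field_simp
    simp
  have hinj : InjOn (fun R => √(R ^ 2 - s ^ 2)) (Ioi |s|) := by
    intro a ha b hb hab
    have h1 : a ^ 2 - s ^ 2 = b ^ 2 - s ^ 2 :=
      (Real.sqrt_inj (hpos a ha).le (hpos b hb).le).1 hab
    have ha' : 0 < a := (abs_nonneg s).trans_lt ha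
    have hb' : 0 < b := (abs_nonneg s).trans_lt hb
    exact (pow_left_inj₀ ha'.le hb'.le two_ne_zero).1 (by linarith)
  rw [← himg, lintegral_image_eq_lintegral_abs_deriv_mul measurableSet_Ioi hd hinj]
  refine setLIntegral_congr_fun measurableSet_Ioi fun R hR => ?_
  have hR0 : 0 < R := (abs_nonneg s).trans_lt hR
  have hs := Real.sqrt_pos.2 (hpos R hR)
  rw [Real.sq_sqrt (hpos R hR).le, add_sub_cancel, Real.sqrt_sq hR0.le, ← mul_assoc,
    ← ENNReal.ofReal_mul (abs_nonneg _), abs_of_pos (by positivity), div_mul_cancel₀ _ hs.ne']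

lemma lintegral_polar_radial (g : ℝ → ENNReal) (hg : Measurable g) :
    ∫⁻ p : ℝ × ℝ, g (p.1 ^ 2 + p.2 ^ 2) =
      ENNReal.ofReal (2 * Real.pi) * ∫⁻ ρ in Ioi (0 : ℝ), ENNReal.ofReal ρ * g (ρ ^ 2) := by
  rw [← lintegral_comp_polarCoord_symm]
  have h : ∀ p : ℝ × ℝ, ENNReal.ofReal p.1 • g ((polarCoord.symm p).1 ^ 2 +
      (polarCoord.symm p).2 ^ 2) = ENNReal.ofReal p.1 * g (p.1 ^ 2) := by
    intro p
    simp only [polarCoord_symm_apply, smul_eq_mul]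
    congr 2
    linear_combination p.1 ^ 2 * Real.sin_sq_add_cos_sq p.2
  simp only [h, polarCoord_target]
  rw [Measure.volume_eq_prod, ← Measure.prod_restrict, lintegral_prod _ (by fun_prop)]
  simp only [lintegral_const, Measure.restrict_apply_univ, Real.volume_Ioo]
  rw [lintegral_mul_const _ (by fun_prop), mul_comm]
  congr 2
  ring

/-- Archimedes' theorem: in the coordinates height s and radius R, volume has density 2πR on |s| <
R, independent of s. It follows from polar coordinates in each horizontal plane. -/
lemma lintegral_cylindrical (F : ℝ → ℝ → ENNReal) (hF : Measurable fun p : ℝ × ℝ => F p.1 p.2) :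
    ∫⁻ y : Space, F (y 0) ‖y‖ =
      ∫⁻ s, ENNReal.ofReal (2 * Real.pi) * ∫⁻ R in Ioi |s|, ENNReal.ofReal R * F s R := by
  have hFs : ∀ s, Measurable (F s) := fun s => hF.comp (measurable_const.prodMk measurable_id)
  have h1 := (PiLp.volume_preserving_ofLp (Fin 3)).lintegral_comp
    (f := fun z : Fin 3 → ℝ => F (z 0) (√(z 0 ^ 2 + (z 1 ^ 2 + z 2 ^ 2))))
    (hF.comp (by fun_prop : Measurable fun z : Fin 3 → ℝ =>
      (z 0, √(z 0 ^ 2 + (z 1 ^ 2 + z 2 ^ 2)))))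
  have h2 := (volume_preserving_piFinSuccAbove (fun _ : Fin 3 => ℝ) 0).lintegral_comp
    (f := fun q : ℝ × (Fin 2 → ℝ) => F q.1 (√(q.1 ^ 2 + (q.2 0 ^ 2 + q.2 1 ^ 2))))
    (hF.comp (by fun_prop : Measurable fun q : ℝ × (Fin 2 → ℝ) =>
      (q.1, √(q.1 ^ 2 + (q.2 0 ^ 2 + q.2 1 ^ 2)))))
  have h3 : ∀ s, ∫⁻ w : Fin 2 → ℝ, F s (√(s ^ 2 + (w 0 ^ 2 + w 1 ^ 2))) =
      ENNReal.ofReal (2 * Real.pi) * ∫⁻ R in Ioi |s|, ENNReal.ofReal R * F s R := by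
    intro s
    have h4 := (volume_preserving_finTwoArrow ℝ).lintegral_comp
      (f := fun p : ℝ × ℝ => F s (√(s ^ 2 + (p.1 ^ 2 + p.2 ^ 2))))
      ((hFs s).comp (by fun_prop))
    refine Eq.trans ?_ (h4.trans ?_)
    · rfl
    · rw [lintegral_polar_radial (fun a => F s (√(s ^ 2 + a))) ((hFs s).comp (by fun_prop)),
        lintegral_sqrt_substitution]
  calc ∫⁻ y : Space, F (y 0) ‖y‖
      = ∫⁻ y : Space, F (y 0) (√(y 0 ^ 2 + (y 1 ^ 2 + y 2 ^ 2))) := by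
        congr 1 with y
        rw [EuclideanSpace.norm_eq]
        simp [Fin.sum_univ_three, add_assoc]
    _ = ∫⁻ z : Fin 3 → ℝ, F (z 0) (√(z 0 ^ 2 + (z 1 ^ 2 + z 2 ^ 2))) := h1
    _ = ∫⁻ q : ℝ × (Fin 2 → ℝ), F q.1 (√(q.1 ^ 2 + (q.2 0 ^ 2 + q.2 1 ^ 2))) := h2
    _ = _ := by
        rw [Measure.volume_eq_prod, lintegral_prod _ (by
          exact (hF.comp (by fun_prop : Measurable fun q : ℝ × (Fin 2 → ℝ) =>
            (q.1, √(q.1 ^ 2 + (q.2 0 ^ 2 + q.2 1 ^ 2))))).aemeasurable)]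
        simp only [h3]

/-- The height of the cap which the ball of radius `r` with centre at distance `d` from the origin
cuts out of the sphere of radius `R` about the origin. -/
def capHeight (d r R : ℝ) : ℝ := max 0 (R - max (-R) ((R ^ 2 + d ^ 2 - r ^ 2) / (2 * d)))

lemma volume_cap {d r R : ℝ} (hd : 0 < d) :
    volume {s : ℝ | |s| < R ∧ R ^ 2 - 2 * d * s + d ^ 2 ≤ r ^ 2} =
      ENNReal.ofReal (capHeight d r R) := by
  have h : ∀ s, R ^ 2 - 2 * d * s + d ^ 2 ≤ r ^ 2 ↔ (R ^ 2 + d ^ 2 - r ^ 2) / (2 * d) ≤ s := by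
    intro s
    rw [div_le_iff₀ (by positivity)]
    constructor <;> intro h <;> linarith
  simp only [h, abs_lt, capHeight]
  generalize (R ^ 2 + d ^ 2 - r ^ 2) / (2 * d) = a
  -- `ENNReal.ofReal` already truncates at 0, so the outer maximum can be dropped.
  rw [max_comm, ENNReal.ofReal_max, ENNReal.ofReal_zero, max_eq_left zero_le]
  rcases le_or_gt a (-R) with ha | ha
  · have : {s | (-R < s ∧ s < R) ∧ a ≤ s} = Ioo (-R) R := by
      ext s
      simp only [mem_ofPred_eq, mem_Ioo]
      exact ⟨fun h => h.1, fun h => ⟨h, by linarith⟩⟩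
    rw [this, Real.volume_Ioo, max_eq_left ha]
  · have : {s | (-R < s ∧ s < R) ∧ a ≤ s} = Ico a R := by
      ext s
      simp only [mem_ofPred_eq, mem_Ico]
      exact ⟨fun h => ⟨h.2, h.1.2⟩, fun h => ⟨⟨by linarith, h.2⟩, h.1⟩⟩
    rw [this, Real.volume_Ico, max_eq_right ha.le]

lemma norm_sub_smul_single_sq (d : ℝ) (y : Space) :
    ‖y - EuclideanSpace.single 0 d‖ ^ 2 = ‖y‖ ^ 2 - 2 * d * y 0 + d ^ 2 := by
  rw [norm_sub_sq_real, EuclideanSpace.inner_single_right]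
  simp
  ring

lemma lintegral_closedBall_norm {v : Space} (hv : v ≠ 0) {r : ℝ} (hr : 0 < r) {k : ℝ → ENNReal}
    (hk : Measurable k) :
    ∫⁻ y in Metric.closedBall v r, k ‖y‖ =
      ∫⁻ R in Ioi (0 : ℝ), ENNReal.ofReal (2 * Real.pi * R * capHeight ‖v‖ r R) * k R := by
  have hd : 0 < ‖v‖ := norm_pos_iff.2 hv
  set d := ‖v‖ with hdef
  let w : Space := EuclideanSpace.single 0 d
  have hw : ‖v‖ = ‖w‖ := by simp [w, ← hdef, abs_of_pos hd]
  -- A reflection carries the centre v to the first axis, so that membership in the ball depends on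
  -- the height and the norm alone.
  let A : Space ≃ₗᵢ[ℝ] Space := (Submodule.span ℝ {v - w})ᗮ.reflection
  have hA : A v = w := Submodule.reflection_sub hw
  let F : ℝ → ℝ → ENNReal := fun s R =>
    {p : ℝ × ℝ | p.2 ^ 2 - 2 * d * p.1 + d ^ 2 ≤ r ^ 2}.indicator (fun p => k p.2) (s, R)
  have hmeas : MeasurableSet {p : ℝ × ℝ | p.2 ^ 2 - 2 * d * p.1 + d ^ 2 ≤ r ^ 2} :=
    measurableSet_le (by fun_prop) (by fun_prop)
  have hF : Measurable fun p : ℝ × ℝ => F p.1 p.2 := (hk.comp measurable_snd).indicator hmeas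
  have e1 : ∫⁻ y in Metric.closedBall v r, k ‖y‖ = ∫⁻ y : Space, F (y 0) ‖y‖ := by
    have h2 := A.measurePreserving.lintegral_comp (f := fun y : Space => F (y 0) ‖y‖)
      (hF.comp (by fun_prop : Measurable fun y : Space => (y 0, ‖y‖)))
    rw [← h2, ← lintegral_indicator Metric.isClosed_closedBall.measurableSet]
    congr 1 with y
    have hiff : y ∈ Metric.closedBall v r ↔ ‖A y‖ ^ 2 - 2 * d * (A y) 0 + d ^ 2 ≤ r ^ 2 := by
      rw [← norm_sub_smul_single_sq, mem_closedBall_iff_norm, ← A.norm_map, map_sub, hA,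
        sq_le_sq₀ (norm_nonneg _) hr.le]
    by_cases hy : y ∈ Metric.closedBall v r
    · rw [indicator_of_mem hy]
      simp only [F]
      rw [indicator_of_mem (by exact hiff.1 hy)]
      simp
    · rw [indicator_of_notMem hy]
      simp only [F]
      rw [indicator_of_notMem (by exact mt hiff.2 hy)]
  have e2 : ∀ s, ∫⁻ R in Ioi |s|, ENNReal.ofReal R * F s R =
      ∫⁻ R, {p : ℝ × ℝ | |p.1| < p.2}.indicator (fun p => ENNReal.ofReal p.2 * F p.1 p.2)
        (s, R) := by
    intro s
    rw [← lintegral_indicator measurableSet_Ioi]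
    rfl
  have hG : Measurable ({p : ℝ × ℝ | |p.1| < p.2}.indicator
      (fun p => ENNReal.ofReal p.2 * F p.1 p.2)) :=
    Measurable.indicator (by fun_prop) (measurableSet_lt (by fun_prop) (by fun_prop))
  rw [e1, lintegral_cylindrical F hF, lintegral_const_mul' _ _ ENNReal.ofReal_ne_top]
  simp only [e2]
  rw [lintegral_lintegral_swap (by exact hG.aemeasurable),
    ← lintegral_const_mul' _ _ ENNReal.ofReal_ne_top, ← lintegral_indicator measurableSet_Ioi]
  congr 1 with R
  rcases le_or_gt R 0 with hR | hR
  · rw [indicator_of_notMem (by simpa using hR)]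
    have : ∀ s : ℝ, (s, R) ∉ {p : ℝ × ℝ | |p.1| < p.2} := fun s h => by
      have h1 : |s| < R := h
      linarith [abs_nonneg s]
    simp [this]
  · rw [indicator_of_mem (by exact hR)]
    have e3 : ∀ s, {p : ℝ × ℝ | |p.1| < p.2}.indicator
        (fun p => ENNReal.ofReal p.2 * F p.1 p.2) (s, R) =
        {s : ℝ | |s| < R ∧ R ^ 2 - 2 * d * s + d ^ 2 ≤ r ^ 2}.indicator
          (fun _ => ENNReal.ofReal R * k R) s := by
      intro s
      by_cases h1 : |s| < R <;> by_cases h2 : R ^ 2 - 2 * d * s + d ^ 2 ≤ r ^ 2 <;>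
        simp [F, indicator, h1, h2]
    have hcap : MeasurableSet {s : ℝ | |s| < R ∧ R ^ 2 - 2 * d * s + d ^ 2 ≤ r ^ 2} :=
      (measurableSet_lt (by fun_prop : Measurable fun s : ℝ => |s|) measurable_const).inter
        (measurableSet_le (by fun_prop : Measurable fun s : ℝ => R ^ 2 - 2 * d * s + d ^ 2)
          measurable_const)
    have hprod : ENNReal.ofReal (2 * Real.pi * R * capHeight d r R) =
        ENNReal.ofReal (2 * Real.pi) * ENNReal.ofReal R * ENNReal.ofReal (capHeight d r R) := by
      rw [ENNReal.ofReal_mul (by positivity), ENNReal.ofReal_mul (by positivity)]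
    simp only [e3]
    rw [lintegral_indicator_const hcap, volume_cap hd, hprod]
    ring

lemma map_norm_closedBall {v : Space} (hv : v ≠ 0) {r : ℝ} (hr : 0 < r) :
    ((volume : Measure Space).restrict (Metric.closedBall v r)).map norm =
      (volume.restrict (Ioi (0 : ℝ))).withDensity fun R =>
        ENNReal.ofReal (2 * Real.pi * R * capHeight ‖v‖ r R) := by
  ext s hs
  rw [← lintegral_indicator_one hs, lintegral_map (measurable_one.indicator hs) measurable_norm,
    lintegral_closedBall_norm hv hr (measurable_one.indicator hs), withDensity_apply _ hs,
    ← lintegral_indicator hs]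
  congr 1 with R
  by_cases h : R ∈ s <;> simp [h]

lemma capHeight_nonneg (d r R : ℝ) : 0 ≤ capHeight d r R := le_max_left _ _

lemma setIntegral_closedBall_norm {v : Space} (hv : v ≠ 0) {r : ℝ} (hr : 0 < r) {g : ℝ → ℝ}
    (hg : Measurable g) :
    ∫ y in Metric.closedBall v r, g ‖y‖ =
      ∫ R in Ioi (0 : ℝ), 2 * Real.pi * R * capHeight ‖v‖ r R * g R := by
  rw [← integral_map (φ := norm) measurable_norm.aemeasurable hg.aestronglyMeasurable,
    map_norm_closedBall hv hr, integral_withDensity_eq_integral_toReal_smul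
      (by unfold capHeight; fun_prop) (by simp)]
  refine setIntegral_congr_fun measurableSet_Ioi fun R (hR : 0 < R) => ?_
  have := capHeight_nonneg ‖v‖ r R
  simp only [smul_eq_mul]
  rw [ENNReal.toReal_ofReal (by positivity)]

/-- For a ball about the origin each sphere of radius R ≤ r lies in it entirely, so 2R replaces the
cap height. The factors are arranged to fit `setIntegral_Ioi_rescale`. -/
lemma setIntegral_closedBall_zero_norm (r : ℝ) (g : ℝ → ℝ) :
    ∫ y in Metric.closedBall (0 : Space) r, g ‖y‖ =
      ∫ R in Ioi (0 : ℝ), 2 * Real.pi * R * (2 * R * chi 0 r R) * g R := by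
  have h := integral_fun_norm_addHaar (volume : Measure Space) ((Iic r).indicator g)
  rw [← integral_indicator Metric.isClosed_closedBall.measurableSet]
  have e : (Metric.closedBall (0 : Space) r).indicator (fun y => g ‖y‖) =
      fun y => (Iic r).indicator g ‖y‖ := by
    ext y
    simp [indicator]
  rw [e, h]
  simp only [finrank_euclideanSpace, Fintype.card_fin, Nat.add_one_sub_one]
  rw [measureReal_def, EuclideanSpace.volume_ball_fin_three]
  simp only [ENNReal.ofReal_one, one_pow, one_mul, smul_eq_mul,
    ENNReal.toReal_ofReal (by positivity : 0 ≤ Real.pi * 4 / 3), nsmul_eq_mul]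
  rw [← integral_const_mul, ← integral_const_mul]
  refine setIntegral_congr_fun measurableSet_Ioi fun R (hR : 0 < R) => ?_
  by_cases hRr : R ≤ r
  · simp [chi, hRr, hR.le]; ring
  · simp [chi, hRr]

/-! ### Explicit formulas -/

lemma setIntegral_newtonMeasure (c : ℝ) {s : Set Space} (hs : MeasurableSet s) (f : Space → ℝ) :
    ∫ y in s, f y ∂(newtonMeasure c) = ∫ y in s, newton c y * f y := by
  rw [← integral_indicator hs, integral_newtonMeasure, ← integral_indicator hs]
  congr 1 with y
  by_cases h : y ∈ s <;> simp [h]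

/-- With R = ct, the area factor 2πR cancels against 1/(4πc²R), and dR = c dt leaves 1/(2c). -/
lemma setIntegral_Ioi_rescale {c : ℝ} (hc : 0 < c) (H φ : ℝ → ℝ) :
    ∫ R in Ioi (0 : ℝ), 2 * Real.pi * R * H R * ((4 * Real.pi * c ^ 2 * R)⁻¹ * φ (R / c)) =
      ∫ t in Ioi (0 : ℝ), H (c * t) / (2 * c) * φ t := by
  have h := integral_comp_mul_left_Ioi
    (fun R => 2 * Real.pi * R * H R * ((4 * Real.pi * c ^ 2 * R)⁻¹ * φ (R / c))) 0 hc
  rw [mul_zero, smul_eq_mul, eq_inv_mul_iff_mul_eq₀ hc.ne'] at h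
  rw [← h, ← integral_const_mul]
  refine setIntegral_congr_fun measurableSet_Ioi fun t (ht : 0 < t) => ?_
  have := Real.pi_pos
  rw [mul_div_cancel_left₀ _ hc.ne']
  field_simp
  ring

lemma waveSlice_apply_capHeight {c r : ℝ} (hc : 0 < c) (hr : 0 < r) {x₀ x : Space} (hx : x ≠ x₀)
    (φ : 𝓓((⊤ : Opens ℝ), ℝ)) : waveSlice c r x₀ x φ =
      ∫ t in Ioi (0 : ℝ), capHeight ‖x - x₀‖ r (c * t) / (2 * c) * φ t := by
  rw [waveSlice_apply_setIntegral, setIntegral_newtonMeasure _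
    Metric.isClosed_closedBall.measurableSet, ← setIntegral_Ioi_rescale hc,
    ← setIntegral_closedBall_norm (sub_ne_zero.2 hx) hr
      (g := fun R => (4 * Real.pi * c ^ 2 * R)⁻¹ * φ (R / c))
      (by have := φ.continuous.measurable; fun_prop)]
  rfl

lemma waveSlice_apply_self {c : ℝ} (hc : 0 < c) (r : ℝ) (x₀ : Space)
    (φ : 𝓓((⊤ : Opens ℝ), ℝ)) : waveSlice c r x₀ x₀ φ =
      ∫ t in Ioi (0 : ℝ), t * chi 0 r (c * t) * φ t := by
  rw [waveSlice_apply_setIntegral, setIntegral_newtonMeasure _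
    Metric.isClosed_closedBall.measurableSet, sub_self]
  refine (setIntegral_closedBall_zero_norm r
    (fun R => (4 * Real.pi * c ^ 2 * R)⁻¹ * φ (R / c))).trans ?_
  rw [setIntegral_Ioi_rescale hc (fun R => 2 * R * chi 0 r R)]
  congr 1 with t
  field_simp

/-- The profile of the spherical wave with data `(0, χ)` at distance `d` from the centre. -/
def profile (c r d t : ℝ) : ℝ := (r ^ 2 - (c * t - d) ^ 2) / (4 * d * c)

lemma continuous_profile (c r d : ℝ) : Continuous (profile c r d) := by
  unfold profile; fun_prop

lemma hasDerivAt_profile {c : ℝ} (hc : 0 < c) (r : ℝ) {d : ℝ} (hd : 0 < d) (t : ℝ) :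
    HasDerivAt (profile c r d) ((d - c * t) / (2 * d)) t := by
  have h1 : HasDerivAt (fun t : ℝ => c * t - d) c t := by
    simpa using ((hasDerivAt_id t).const_mul c).sub_const d
  refine ((((h1.fun_pow 2).const_sub (r ^ 2)).div_const (4 * d * c))).congr_deriv ?_
  simp only [Nat.cast_ofNat, Nat.add_one_sub_one, pow_one]
  field_simp
  ring

lemma profile_eq {c r d t : ℝ} (hc : 0 < c) (hd : 0 < d) (ht : 0 < t) :
    profile c r d t = t / 2 * (1 - ((c * t) ^ 2 + d ^ 2 - r ^ 2) / (2 * d * c * t)) := by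
  unfold profile
  field_simp
  ring

lemma chi_of_mem {a b s : ℝ} (h1 : a ≤ s) (h2 : s ≤ b) : chi a b s = 1 :=
  indicator_of_mem (show s ∈ Icc a b from ⟨h1, h2⟩) _

lemma chi_of_lt {a b s : ℝ} (h : s < a) : chi a b s = 0 :=
  indicator_of_notMem (fun hs : s ∈ Icc a b => h.not_ge hs.1) _

lemma chi_of_gt {a b s : ℝ} (h : b < s) : chi a b s = 0 :=
  indicator_of_notMem (fun hs : s ∈ Icc a b => h.not_ge hs.2) _

lemma sub_capBottom {d r R : ℝ} (hd : 0 < d) :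
    R - (R ^ 2 + d ^ 2 - r ^ 2) / (2 * d) = (r ^ 2 - (R - d) ^ 2) / (2 * d) := by
  field_simp
  ring

/-- When r ≤ R + d the far pole of the sphere is not interior to the ball, so the lower truncation
at −R is inactive. -/
lemma capHeight_of_dist_le {d r R : ℝ} (hd : 0 < d) (hr : 0 < r)
    (h : r ≤ R + d) :
    capHeight d r R = (r ^ 2 - (R - d) ^ 2) / (2 * d) * chi (d - r) (d + r) R := by
  have h1 : -R ≤ (R ^ 2 + d ^ 2 - r ^ 2) / (2 * d) := by
    rw [le_div_iff₀ (by positivity)]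
    nlinarith
  rw [capHeight, max_eq_right h1, sub_capBottom hd]
  by_cases hlo : R < d - r
  · rw [chi_of_lt hlo, mul_zero, max_eq_left]
    exact div_nonpos_of_nonpos_of_nonneg (by nlinarith) (by positivity)
  by_cases hhi : d + r < R
  · rw [chi_of_gt hhi, mul_zero, max_eq_left]
    exact div_nonpos_of_nonpos_of_nonneg (by nlinarith) (by positivity)
  rw [chi_of_mem (by linarith) (by linarith), mul_one, max_eq_right]
  exact div_nonneg (by nlinarith) (by positivity)

/-- At R = r − d both closed intervals contain R and the right side would count the height 2R twice;
hence the exclusion. -/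
lemma capHeight_inside {d r R : ℝ} (hd : 0 < d) (hdr : d ≤ r) (hR : 0 < R) (hne : R ≠ r - d) :
    capHeight d r R = 2 * R * chi 0 (r - d) R
      + (r ^ 2 - (R - d) ^ 2) / (2 * d) * chi (r - d) (r + d) R := by
  rcases lt_or_gt_of_ne hne with h | h
  · have h1 : (R ^ 2 + d ^ 2 - r ^ 2) / (2 * d) ≤ -R := by
      rw [div_le_iff₀ (by positivity)]
      nlinarith
    rw [capHeight, max_eq_left h1, chi_of_mem hR.le h.le, chi_of_lt h, max_eq_right (by linarith)]
    ring
  · rw [capHeight_of_dist_le hd (by linarith) (by linarith), chi_of_gt (a := 0) h, mul_zero,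
      zero_add]
    congr 1
    by_cases hhi : d + r < R
    · rw [chi_of_gt hhi, chi_of_gt (by linarith)]
    · rw [chi_of_mem (by linarith) (by linarith), chi_of_mem (by linarith) (by linarith)]

/-! ### Integrals over time windows -/

section chi

variable {c a b : ℝ} {F : ℝ → ℝ}

lemma mul_chi_mul_eq_indicator (hc : 0 < c) (F φ : ℝ → ℝ) (a b : ℝ) :
    (fun t => F t * chi a b (c * t) * φ t) =
      (Icc (a / c) (b / c)).indicator fun t => F t * φ t := by
  ext t
  have hiff : t ∈ Icc (a / c) (b / c) ↔ c * t ∈ Icc a b := by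
    simp only [mem_Icc, div_le_iff₀ hc, le_div_iff₀ hc, mul_comm c]
  by_cases h : t ∈ Icc (a / c) (b / c)
  · rw [indicator_of_mem h, chi, indicator_of_mem (hiff.1 h), mul_one]
  · rw [indicator_of_notMem h, chi, indicator_of_notMem (mt hiff.2 h), mul_zero, zero_mul]

lemma integrable_mul_chi_mul (hc : 0 < c) (hF : Continuous F) {φ : ℝ → ℝ} (hφ : Continuous φ)
    (a b : ℝ) : Integrable fun t => F t * chi a b (c * t) * φ t := by
  rw [mul_chi_mul_eq_indicator hc]
  exact IntegrableOn.integrable_indicator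
    ((hF.mul hφ).continuousOn.integrableOn_compact isCompact_Icc) measurableSet_Icc

lemma integral_mul_chi_mul (hc : 0 < c) (ha : 0 ≤ a) (hab : a ≤ b) (F φ : ℝ → ℝ) :
    ∫ t in Ioi (0 : ℝ), F t * chi a b (c * t) * φ t = ∫ t in (a / c)..(b / c), F t * φ t := by
  rw [mul_chi_mul_eq_indicator hc, ← integral_Ici_eq_integral_Ioi,
    setIntegral_indicator measurableSet_Icc,
    intervalIntegral.integral_of_le (div_le_div_of_nonneg_right hab hc.le),
    ← integral_Icc_eq_integral_Ioc]
  congr 2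
  exact inter_eq_right.2 fun t ht => (div_nonneg ha hc.le).trans ht.1

lemma isGivenBy_chi (hc : 0 < c) (ha : 0 ≤ a) (hab : a ≤ b) (hF : Continuous F)
    {T : 𝓓'((⊤ : Opens ℝ), ℝ)} (hT : ∀ φ, T φ = ∫ t in (a / c)..(b / c), F t * φ t) :
    IsGivenBy T fun t => F t * chi a b (c * t) := fun φ =>
  ⟨(integrable_mul_chi_mul hc hF φ.continuous a b).integrableOn, by
    rw [hT, integral_mul_chi_mul hc ha hab]⟩

lemma isGivenBy_chi_add_chi (hc : 0 < c) {e : ℝ} (ha : 0 ≤ a) (hab : a ≤ b) (hbe : b ≤ e)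
    {G : ℝ → ℝ} (hF : Continuous F) (hG : Continuous G) {T : 𝓓'((⊤ : Opens ℝ), ℝ)}
    (hT : ∀ φ, T φ =
      (∫ t in (a / c)..(b / c), F t * φ t) + ∫ t in (b / c)..(e / c), G t * φ t) :
    IsGivenBy T fun t => F t * chi a b (c * t) + G t * chi b e (c * t) := fun φ => by
  have h1 := (integrable_mul_chi_mul hc hF φ.continuous a b).integrableOn (s := Ioi 0)
  have h2 := (integrable_mul_chi_mul hc hG φ.continuous b e).integrableOn (s := Ioi 0)
  simp only [add_mul]
  refine ⟨h1.add h2, ?_⟩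
  rw [hT, integral_add h1 h2, integral_mul_chi_mul hc ha hab,
    integral_mul_chi_mul hc (ha.trans hab) hbe]

end chi

lemma IsGivenBy.congr {T : 𝓓'((⊤ : Opens ℝ), ℝ)} {h k : ℝ → ℝ} (hT : IsGivenBy T h)
    (hk : ∀ t, 0 < t → h t = k t) : IsGivenBy T k := fun φ => by
  have he : EqOn (fun t => h t * φ t) (fun t => k t * φ t) (Ioi 0) := fun t ht => by
    simp only [hk t ht]
  exact ⟨(hT φ).1.congr_fun he measurableSet_Ioi, by
    rw [(hT φ).2, setIntegral_congr_fun measurableSet_Ioi he]⟩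

section waveSlice

variable {c r : ℝ} (hc : 0 < c) (hr : 0 < r) {x₀ x : Space}

include hc hr

lemma waveSlice_outside (hx : r < ‖x - x₀‖) (φ : 𝓓((⊤ : Opens ℝ), ℝ)) :
    waveSlice c r x₀ x φ = ∫ t in ((‖x - x₀‖ - r) / c)..((‖x - x₀‖ + r) / c),
      profile c r ‖x - x₀‖ t * φ t := by
  have hd : 0 < ‖x - x₀‖ := hr.trans hx
  rw [waveSlice_apply_capHeight hc hr (sub_ne_zero.1 (norm_pos_iff.1 hd)),
    ← integral_mul_chi_mul hc (by linarith) (by linarith)]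
  refine setIntegral_congr_fun measurableSet_Ioi fun t (ht : 0 < t) => ?_
  have : 0 < c * t := by positivity
  rw [capHeight_of_dist_le hd hr (by linarith), profile]
  field_simp
  ring

lemma waveSlice_inside (hx : ‖x - x₀‖ ≤ r) (hne : x ≠ x₀) (φ : 𝓓((⊤ : Opens ℝ), ℝ)) :
    waveSlice c r x₀ x φ = (∫ t in (0 / c)..((r - ‖x - x₀‖) / c), t * φ t) +
      ∫ t in ((r - ‖x - x₀‖) / c)..((r + ‖x - x₀‖) / c), profile c r ‖x - x₀‖ t * φ t := by
  have hd : 0 < ‖x - x₀‖ := norm_pos_iff.2 (sub_ne_zero.2 hne)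
  rw [waveSlice_apply_capHeight hc hr hne,
    ← integral_mul_chi_mul hc (by linarith) (by linarith),
    ← integral_mul_chi_mul hc (by linarith) (by linarith),
    ← integral_add (integrable_mul_chi_mul hc (F := fun t => t) continuous_id φ.continuous _
        _).integrableOn
      (integrable_mul_chi_mul hc (continuous_profile _ _ _) φ.continuous _ _).integrableOn]
  -- The two windows share the instant t = (r − d)/c, so the densities agree only almost everywhere.
  refine integral_congr_ae ?_
  filter_upwards [ae_restrict_mem measurableSet_Ioi,
    ae_restrict_of_ae (Measure.ae_ne volume ((r - ‖x - x₀‖) / c))] with t (ht : 0 < t) htne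
  rw [capHeight_inside hd hx (by positivity) fun h => htne (by rw [← h]; field_simp), profile]
  field_simp
  ring

omit hr in
lemma waveSlice_center (hr : 0 ≤ r) (φ : 𝓓((⊤ : Opens ℝ), ℝ)) :
    waveSlice c r x₀ x₀ φ = ∫ t in (0 / c)..(r / c), t * φ t := by
  rw [waveSlice_apply_self hc, ← integral_mul_chi_mul hc le_rfl hr]

end waveSlice

/-! ### Time derivatives of the values -/

lemma lineDerivOp_one_apply (T : 𝓓'((⊤ : Opens ℝ), ℝ)) (φ : 𝓓((⊤ : Opens ℝ), ℝ)) :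
    (∂_{(1 : ℝ)} T) φ = -T (∂_{(1 : ℝ)} φ) := by
  rw [Distribution.lineDerivOp_apply_apply, map_neg]

lemma integral_mul_lineDerivOp {F F' : ℝ → ℝ} (hF : ∀ t, HasDerivAt F (F' t) t)
    (hF' : Continuous F') (φ : 𝓓((⊤ : Opens ℝ), ℝ)) (a b : ℝ) :
    ∫ t in a..b, F t * (∂_{(1 : ℝ)} φ : 𝓓((⊤ : Opens ℝ), ℝ)) t =
      F b * φ b - F a * φ a - ∫ t in a..b, F' t * φ t := by
  have h : ⇑(∂_{(1 : ℝ)} φ : 𝓓((⊤ : Opens ℝ), ℝ)) = deriv φ := by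
    rw [lineDerivOp_testFunction_apply]
    ext t
    exact fderiv_apply_one_eq_deriv
  refine intervalIntegral.integral_mul_deriv_eq_deriv_mul (fun t _ => hF t) (fun t _ => ?_)
    (hF'.intervalIntegrable _ _)
    ((∂_{(1 : ℝ)} φ : 𝓓((⊤ : Opens ℝ), ℝ)).continuous.intervalIntegrable _ _)
  rw [h]
  exact ((φ.contDiff.differentiable (by simp)) t).hasDerivAt

/-- This and the next two endpoint values make the boundary terms cancel off the centre: the profile
vanishes at ct = d ± r and joins the density t continuously at ct = r − d. -/
lemma profile_dist_add {c r d : ℝ} (hc : 0 < c) : profile c r d ((d + r) / c) = 0 := by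
  rw [profile, mul_div_cancel₀ _ hc.ne']
  ring

lemma profile_dist_sub {c r d : ℝ} (hc : 0 < c) : profile c r d ((d - r) / c) = 0 := by
  rw [profile, mul_div_cancel₀ _ hc.ne']
  ring

lemma profile_sub_dist {c r d : ℝ} (hc : 0 < c) (hd : 0 < d) :
    profile c r d ((r - d) / c) = (r - d) / c := by
  rw [profile, mul_div_cancel₀ _ hc.ne']
  field_simp
  ring

section timeDeriv

variable {c r : ℝ} (hc : 0 < c) (hr : 0 < r) {x₀ x : Space}

include hc hr

lemma isGivenBy_timeDeriv_outside (hx : r < ‖x - x₀‖) :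
    IsGivenBy (∂_{(1 : ℝ)} (waveSlice c r x₀ x)) fun t =>
      (‖x - x₀‖ - c * t) / (2 * ‖x - x₀‖) * chi (‖x - x₀‖ - r) (‖x - x₀‖ + r) (c * t) := by
  refine isGivenBy_chi hc (by linarith) (by linarith) (by fun_prop) fun φ => ?_
  rw [lineDerivOp_one_apply, waveSlice_outside hc hr hx,
    integral_mul_lineDerivOp (hasDerivAt_profile hc r (hr.trans hx)) (by fun_prop),
    profile_dist_add hc, profile_dist_sub hc]
  ring

lemma isGivenBy_timeDeriv_inside (hx : ‖x - x₀‖ ≤ r) (hne : x ≠ x₀) :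
    IsGivenBy (∂_{(1 : ℝ)} (waveSlice c r x₀ x)) fun t =>
      1 * chi 0 (r - ‖x - x₀‖) (c * t) +
        (‖x - x₀‖ - c * t) / (2 * ‖x - x₀‖) * chi (r - ‖x - x₀‖) (r + ‖x - x₀‖) (c * t) := by
  have hd : 0 < ‖x - x₀‖ := norm_pos_iff.2 (sub_ne_zero.2 hne)
  refine isGivenBy_chi_add_chi (F := fun _ => 1) hc le_rfl (by linarith) (by linarith)
    (by fun_prop) (by fun_prop) fun φ => ?_
  rw [lineDerivOp_one_apply, waveSlice_inside hc hr hx hne,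
    integral_mul_lineDerivOp (hasDerivAt_profile hc r hd) (by fun_prop),
    integral_mul_lineDerivOp (fun t => hasDerivAt_id' t) (by fun_prop),
    add_comm r, profile_dist_add hc, profile_sub_dist hc hd]
  ring

/-- The density t drops from r/c to 0 at t = r/c, so integration by parts leaves −(r/c)φ(r/c). This
is the pairing with −ct δ(r − ct), since δ(r − ct) has mass 1/c. -/
lemma timeDeriv_center (φ : 𝓓((⊤ : Opens ℝ), ℝ)) :
    (∂_{(1 : ℝ)} (waveSlice c r x₀ x₀)) φ = (∫ t in Ioi (0 : ℝ), chi 0 r (c * t) * φ t)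
      - c * deltaPairing r c (fun t => t * φ t) := by
  have h := integral_mul_chi_mul hc le_rfl hr.le (fun _ => 1) φ
  simp only [one_mul] at h
  rw [lineDerivOp_one_apply, waveSlice_center hc hr.le,
    integral_mul_lineDerivOp (fun t => hasDerivAt_id' t) (by fun_prop), h, deltaPairing,
    abs_of_pos hc]
  field_simp
  simp

end timeDeriv

end WaveCauchy

end

open WaveCauchy in
theorem proposition3 (c r : ℝ) (hc : 0 < c) (hr : 0 < r) (x₀ : Space) :
    -- data `(χ, 0)`
    ((∃! U, IsSolution c (ballChar x₀ r) (fun _ => 0) U) ∧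
      ∀ U, IsSolution c (ballChar x₀ r) (fun _ => 0) U →
        (∃! u, IsValueAtPoints U u) ∧
        ∀ u, IsValueAtPoints U u →
          (∀ (x : Space) (d : ℝ), d = ‖x - x₀‖ → x ∉ Metric.closedBall x₀ r →
            IsGivenBy (u x) fun t =>
              (d - c * t) / (2 * d) * chi (d - r) (d + r) (c * t)) ∧
          (∀ (x : Space) (d : ℝ), d = ‖x - x₀‖ → x ∈ Metric.closedBall x₀ r → x ≠ x₀ →
            IsGivenBy (u x) fun t =>
              chi 0 (r - d) (c * t) + (d - c * t) / (2 * d) * chi (r - d) (r + d) (c * t)) ∧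
          (∀ φ : 𝓓((⊤ : Opens ℝ), ℝ),
            u x₀ φ = (∫ t in Ioi (0 : ℝ), chi 0 r (c * t) * φ t)
              - c * deltaPairing r c (fun t => t * φ t))) ∧
    -- data `(0, χ)`
    ((∃! U, IsSolution c (fun _ => 0) (ballChar x₀ r) U) ∧
      ∀ U, IsSolution c (fun _ => 0) (ballChar x₀ r) U →
        (∃! u, IsValueAtPoints U u) ∧
        ∀ u, IsValueAtPoints U u →
          (∀ (x : Space) (d : ℝ), d = ‖x - x₀‖ → x ∉ Metric.closedBall x₀ r →
            IsGivenBy (u x) fun t =>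
              t / 2 * (1 - ((c * t) ^ 2 + d ^ 2 - r ^ 2) / (2 * d * c * t))
                * chi (d - r) (d + r) (c * t)) ∧
          (∀ (x : Space) (d : ℝ), d = ‖x - x₀‖ → x ∈ Metric.closedBall x₀ r → x ≠ x₀ →
            IsGivenBy (u x) fun t =>
              t * chi 0 (r - d) (c * t)
                + t / 2 * (1 - ((c * t) ^ 2 + d ^ 2 - r ^ 2) / (2 * d * c * t))
                  * chi (r - d) (r + d) (c * t)) ∧
          IsGivenBy (u x₀) fun t => t * chi 0 r (c * t)) := by
  have hsol := isSolution_waveDistribution hc r x₀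
  have hval := isValueAtPoints_waveDistribution hc r x₀
  have hout : ∀ {x : Space}, x ∉ Metric.closedBall x₀ r → r < ‖x - x₀‖ := fun h => by
    simpa [dist_eq_norm] using h
  have hin : ∀ {x : Space}, x ∈ Metric.closedBall x₀ r → ‖x - x₀‖ ≤ r := fun h => by
    simpa [dist_eq_norm] using h
  -- By uniqueness, any solution and any family of values may be replaced by the explicit ones.
  refine ⟨⟨⟨_, hsol.timeDeriv, fun V hV => hV.unique hc hsol.timeDeriv⟩, fun U hU => ?_⟩,
    ⟨⟨_, hsol, fun V hV => hV.unique hc hsol⟩, fun U hU => ?_⟩⟩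
  · obtain rfl := hU.unique hc hsol.timeDeriv
    refine ⟨⟨_, hval.timeDeriv, fun v hv => hv.unique hval.timeDeriv⟩, fun u hu => ?_⟩
    obtain rfl := hu.unique hval.timeDeriv
    refine ⟨?_, ?_, fun φ => timeDeriv_center hc hr φ⟩
    · rintro x d rfl hx
      exact isGivenBy_timeDeriv_outside hc hr (hout hx)
    · rintro x d rfl hx hne
      simpa only [one_mul] using isGivenBy_timeDeriv_inside hc hr (hin hx) hne
  · obtain rfl := hU.unique hc hsol
    refine ⟨⟨_, hval, fun v hv => hv.unique hval⟩, fun u hu => ?_⟩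
    obtain rfl := hu.unique hval
    refine ⟨?_, ?_, isGivenBy_chi hc le_rfl hr.le continuous_id (waveSlice_center hc hr.le)⟩
    · rintro x d rfl hx
      have hx' := hout hx
      refine (isGivenBy_chi hc (by linarith) (by linarith) (continuous_profile _ _ _)
        (waveSlice_outside hc hr hx')).congr fun t ht => ?_
      rw [profile_eq hc (hr.trans hx') ht]
    · rintro x d rfl hx hne
      have hx' := hin hx
      have hd : 0 < ‖x - x₀‖ := norm_pos_iff.2 (sub_ne_zero.2 hne)
      refine (isGivenBy_chi_add_chi hc le_rfl (by linarith) (by linarith) continuous_id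
        (continuous_profile _ _ _) (waveSlice_inside hc hr hx' hne)).congr fun t ht => ?_
      rw [profile_eq hc hd ht, id]
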